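/- For $n\ge 0$ let $\mathcal P_n$ be the set of lattice path matroids on the ground set $[n]=\{1,\dots,n\}$. Such a matroid $M[U,L]$ is given by two monotone lattice paths with $n$ steps and the same end points, the lower path never going above the upper path, where $U$ and $L$ are the sets of indices of the north steps of the upper and of the lower path; its bases are the sets of north steps of the lattice paths with the same end points running between the two. Order $\mathcal P_n$ by $M'\le_q M$ if $M'$ is a quotient of $M$, that is, if there are a matroid $N$ and a subset $T$ of its ground set with $M=N\setminus T$ and $M'=N/T$. Its least element is $\hat 0=U_{0,n}$ and its greatest element is $\hat 1=U_{n,n}$. Label a cover relation $M[U',L']\lessdot M[U,L]$ by the pair $(u,\ell)\in[n]\times[n]$ with $U\setminus U'=\{u\}$ and $L\setminus L'=\{\ell\}$ (the good pair labeling), where the labels are ordered by $(u',\ell')\le(u,\ell)$ if $u\le u'$ and $\ell\le \ell'$. A falling chain of $\mathcal P_n$ is a maximal chain $\hat 0=x_0\lessdot x_1\lessdot\dots\lessdot x_r=\hat 1$ in which, for all $0<i<r$, the label of $x_{i-1}\lessdot x_i$ is not smaller than the label of $x_i\lessdot x_{i+1}$. Let $\mathcal F_n$ be the set of falling chains of $\mathcal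 P_n$, and let $\mu(\mathcal P_n)=\mu(\hat 0,\hat 1)$ be the value of the Möbius function of $\mathcal P_n$ on the pair $(\hat 0,\hat 1)$. Then for every $n\ge 2$ $$|\mathcal F_{n+1}|\ \ge\ (n+1)\,|\mathcal F_n| ,$$ and for every $n\ge 0$ $$(-1)^n\mu(\mathcal P_n)\ \ge\ n! .$$ -/

import Mathlib

open Set

noncomputable section

namespace LatticePath

/-! ### Matroid quotients -/

/-- `M'` is a quotient of `M`: there are a (finite) matroid `N` and a subset `T` of its ground set
with `M = N \ T` (deletion) and `M' = N / T` (contraction). -/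
def IsQuotient (M' M : Matroid ℕ) : Prop :=
  ∃ (N : Matroid ℕ) (T : Set ℕ),
    N.Finite ∧ T ⊆ N.E ∧ M = N.delete T ∧ M' = N.contract T

/-- The easy half of the description of quotients by closure operators. -/
lemma IsQuotient.closure_subset {M' M : Matroid ℕ} (h : IsQuotient M' M) (X : Set ℕ) :
    M.closure X ⊆ M'.closure X := by
  obtain ⟨N, T, -, -, rfl, rfl⟩ := h
  rw [Matroid.delete_closure_eq, Matroid.contract_closure_eq]
  exact sdiff_subset_sdiff_left
    (N.closure_subset_closure (sdiff_subset.trans subset_union_left))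

lemma IsQuotient.ground_eq {M' M : Matroid ℕ} (h : IsQuotient M' M) : M'.E = M.E := by
  obtain ⟨N, T, -, -, rfl, rfl⟩ := h
  simp

/-- The other half: a comparison of closure operators is realized by a common extension. It is
needed to see that the quotient relation is transitive. -/
lemma isQuotient_of_closure {M' M : Matroid ℕ} (hfin : M.E.Finite) (hE : M'.E = M.E)
    (hcl : ∀ X, M.closure X ⊆ M'.closure X) : IsQuotient M' M := by
  classical
  have hMF : M.Finite := ⟨hfin⟩
  have hMF' : M'.Finite := ⟨hE ▸ hfin⟩
  have hind : ∀ X, M'.Indep X → M.Indep X := by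
    intro X hX
    rw [Matroid.indep_iff_forall_notMem_closure_sdiff (hE ▸ hX.subset_ground)]
    intro e he hc
    exact (Matroid.indep_iff_forall_notMem_closure_sdiff hX.subset_ground).1 hX he (hcl _ hc)
  -- finite ranks
  obtain ⟨r, hr⟩ : ∃ r : Set ℕ → ℕ, ∀ X, M'.eRk X = (r X : ℕ∞) := by
    refine ⟨fun X => (M'.eRk X).toNat, fun X => (ENat.natCast_toNat ?_).symm⟩
    exact Matroid.eRk_ne_top_iff.2 (Matroid.isRkFinite_set M' X)
  have hrmono : ∀ X Y, X ⊆ Y → r X ≤ r Y := by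
    intro X Y h
    have := M'.eRk_mono h
    rw [hr, hr] at this
    exact_mod_cast this
  have hr0 : r ∅ = 0 := by
    have := M'.eRk_empty
    rw [hr] at this
    exact_mod_cast this
  obtain ⟨B₀, hB₀⟩ := M.exists_isBase
  have hB₀f : B₀.Finite := hfin.subset hB₀.subset_ground
  have hrE : ∀ B, M.IsBase B → r B = r M.E := by
    intro B hB
    have h1 : M'.closure B = M'.E := by
      refine (M'.closure_subset_ground B).antisymm ?_
      rw [hE, ← hB.closure_eq]
      exact hcl B
    have h2 := M'.eRk_closure_eq B
    rw [h1, hE, hr, hr] at h2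
    exact_mod_cast h2.symm
  have hrle : ∀ X Y, X ⊆ Y → Y.Finite → r Y + X.ncard ≤ r X + Y.ncard := by
    intro X Y hXY hY
    have h := M'.eRk_union_le_eRk_add_encard X (Y \ X)
    rw [union_sdiff_cancel hXY, hr, hr, ← (hY.sdiff).cast_ncard_eq] at h
    have h' : r Y ≤ r X + (Y \ X).ncard := by exact_mod_cast h
    have := Set.ncard_sdiff_add_ncard_of_subset hXY hY
    omega
  obtain ⟨k, hk⟩ : ∃ k, B₀.ncard = r M.E + k := by
    refine Nat.exists_eq_add_of_le ?_
    rw [← hrE _ hB₀]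
    have := hrle ∅ B₀ (empty_subset _) hB₀f
    simp [hr0] at this
    exact this
  have hindk : ∀ X, M.Indep X → X.ncard ≤ r X + k := by
    intro X hX
    obtain ⟨B, hB, hXB⟩ := hX.exists_isBase_superset
    have h1 := hrle X B hXB (hfin.subset hB.subset_ground)
    have h2 := hB.ncard_eq_ncard_of_isBase hB₀
    have h3 := hrE B hB
    omega
  -- the new elements
  obtain ⟨T, hTE, hTk⟩ : ∃ T : Finset ℕ, (T : Set ℕ) ⊆ M.Eᶜ ∧ T.card = k :=
    (hfin.infinite_compl).exists_subset_card_eq k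
  have hdisj : Disjoint M.E (T : Set ℕ) := by
    rw [Set.disjoint_left]
    intro a ha hb
    exact hTE hb ha
  have hGf : (M.E ∪ (T : Set ℕ)).Finite := hfin.union T.finite_toSet
  let Ind : Set ℕ → Prop := fun Y => Y ⊆ M.E ∪ T ∧ M.Indep (Y ∩ M.E) ∧ Y.ncard ≤ r (Y ∩ M.E) + k
  have hins : ∀ e ∈ M.E, ∀ Y : Set ℕ, (insert e Y) ∩ M.E = insert e (Y ∩ M.E) := by
    intro e he Y
    rw [insert_inter_of_mem he]
  have hsplit : ∀ Y : Set ℕ, Y ⊆ M.E ∪ T → Y.ncard = (Y ∩ M.E).ncard + (Y ∩ T).ncard := by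
    intro Y hY
    rw [← Set.ncard_union_eq (hdisj.mono inter_subset_right inter_subset_right)
      ((hGf.subset hY).inter_of_left _) ((hGf.subset hY).inter_of_left _),
      ← inter_union_distrib_left, inter_eq_left.2 hY]
  let IM : IndepMatroid ℕ := IndepMatroid.ofFinite (E := M.E ∪ T) hGf Ind
    (by refine ⟨empty_subset _, by simp, by simp⟩)
    (by
      rintro I J ⟨hJ1, hJ2, hJ3⟩ hIJ
      refine ⟨hIJ.trans hJ1, hJ2.subset (inter_subset_inter_left _ hIJ), ?_⟩
      have hI1 := hIJ.trans hJ1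
      have h1 := hsplit I hI1
      have h2 := hsplit J hJ1
      have h3 := hrle (I ∩ M.E) (J ∩ M.E) (inter_subset_inter_left _ hIJ)
        ((hGf.subset hJ1).inter_of_left _)
      have h4 : (I ∩ T).ncard ≤ (J ∩ T).ncard :=
        Set.ncard_le_ncard (inter_subset_inter_left _ hIJ) ((hGf.subset hJ1).inter_of_left _)
      omega)
    (by
      rintro I J ⟨hI1, hI2, hI3⟩ ⟨hJ1, hJ2, hJ3⟩ hlt
      have hIf := hGf.subset hI1
      have hJf := hGf.subset hJ1
      rcases Nat.lt_or_ge I.ncard (r (I ∩ M.E) + k) with h | h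
      · by_cases hT : J ∩ T ⊆ I
        · have h4 : (J ∩ T).ncard ≤ (I ∩ T).ncard :=
            Set.ncard_le_ncard (subset_inter hT inter_subset_right) (hIf.inter_of_left _)
          have h1 := hsplit I hI1
          have h2 := hsplit J hJ1
          have h5 : (I ∩ M.E).encard < (J ∩ M.E).encard := by
            rw [← (hIf.inter_of_left _).cast_ncard_eq, ← (hJf.inter_of_left _).cast_ncard_eq]
            exact_mod_cast (by omega)
          obtain ⟨e, he, hei⟩ := hI2.exists_insert_of_encard_lt hJ2 h5
          have heI : e ∉ I := fun hh => he.2 ⟨hh, he.1.2⟩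
          refine ⟨e, he.1.1, heI, insert_subset (hJ1 he.1.1) hI1, ?_, ?_⟩
          · rw [hins e he.1.2]; exact hei
          · rw [hins e he.1.2, Set.ncard_insert_of_notMem heI hIf]
            have := hrmono (I ∩ M.E) (insert e (I ∩ M.E)) (subset_insert _ _)
            omega
        · obtain ⟨e, he, heI⟩ := not_subset.1 hT
          have heE : e ∉ M.E := fun hh => hdisj.notMem_of_mem_left hh he.2
          have h6 : insert e I ∩ M.E = I ∩ M.E := insert_inter_of_notMem heE
          refine ⟨e, he.1, heI, insert_subset (hJ1 he.1) hI1, ?_, ?_⟩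
          · rw [h6]; exact hI2
          · rw [h6, Set.ncard_insert_of_notMem heI hIf]
            omega
      · have h5 : M'.eRk (I ∩ M.E) < M'.eRk (J ∩ M.E) := by
          rw [hr, hr]
          exact_mod_cast (by omega)
        obtain ⟨e, he, her⟩ := Matroid.exists_eRk_insert_eq_add_one_of_lt h5
        have heI : e ∉ I := fun hh => he.2 ⟨hh, he.1.2⟩
        have hecl : e ∉ M'.closure (I ∩ M.E) := by
          intro hc
          have h7 := M'.eRk_insert_closure_eq e (I ∩ M.E)
          rw [insert_eq_of_mem hc, Matroid.eRk_closure_eq, her, hr] at h7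
          have : r (I ∩ M.E) = r (I ∩ M.E) + 1 := by exact_mod_cast h7
          omega
        have her' : r (insert e (I ∩ M.E)) = r (I ∩ M.E) + 1 := by
          rw [hr, hr] at her
          exact_mod_cast her
        refine ⟨e, he.1.1, heI, insert_subset (hJ1 he.1.1) hI1, ?_, ?_⟩
        · rw [hins e he.1.2]
          exact ((hI2.notMem_closure_iff he.1.2).1 (fun hc => hecl (hcl _ hc))).1
        · rw [hins e he.1.2, Set.ncard_insert_of_notMem heI hIf, her']
          omega)
    (fun I hI => hI.1)
  have hIM : ∀ Y, IM.matroid.Indep Y ↔ Ind Y := fun Y => Iff.rfl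
  have hIME : IM.matroid.E = M.E ∪ T := rfl
  have hTind : IM.matroid.Indep (T : Set ℕ) := by
    rw [hIM]
    have h0 : (T : Set ℕ) ∩ M.E = ∅ := hdisj.symm.inter_eq
    refine ⟨subset_union_right, ?_, ?_⟩
    · rw [h0]; exact M.empty_indep
    · rw [Set.ncard_coe_finset, hTk]; omega
  refine ⟨IM.matroid, T, ⟨hGf⟩, subset_union_right, ?_, ?_⟩
  · refine Matroid.ext_indep ?_ ?_
    · rw [Matroid.delete_ground, hIME, union_sdiff_right, hdisj.sdiff_eq_left]
    · intro I hI
      have h0 : I ∩ M.E = I := inter_eq_left.2 hI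
      rw [Matroid.delete_indep_iff, hIM]
      constructor
      · intro h
        refine ⟨⟨hI.trans subset_union_left, by rw [h0]; exact h, ?_⟩, hdisj.mono_left hI⟩
        rw [h0]; exact hindk I h
      · rintro ⟨⟨-, h, -⟩, -⟩
        rwa [h0] at h
  · refine Matroid.ext_indep ?_ ?_
    · rw [Matroid.contract_ground, hIME, union_sdiff_right, hdisj.sdiff_eq_left, hE]
    · intro I hI
      rw [hE] at hI
      have hIf := hfin.subset hI
      have hIT : Disjoint I (T : Set ℕ) := hdisj.mono_left hI
      have h0 : (I ∪ T) ∩ M.E = I := by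
        rw [union_inter_distrib_right, hdisj.symm.inter_eq, union_empty, inter_eq_left.2 hI]
      have hc : (I ∪ T : Set ℕ).ncard = I.ncard + k := by
        rw [Set.ncard_union_eq hIT hIf T.finite_toSet, Set.ncard_coe_finset, hTk]
      rw [hTind.contract_indep_iff, hIM]
      constructor
      · intro h
        refine ⟨hIT, union_subset_union_left _ hI, by rw [h0]; exact hind I h, ?_⟩
        have h1 := h.eRk_eq_encard
        rw [hr, ← hIf.cast_ncard_eq] at h1
        have h1' : r I = I.ncard := by exact_mod_cast h1
        rw [h0, hc, h1']
      · rintro ⟨-, -, -, h⟩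
        rw [h0, hc] at h
        rw [Matroid.indep_iff_eRk_eq_encard_of_finite hIf]
        refine le_antisymm (M'.eRk_le_encard I) ?_
        rw [hr, ← hIf.cast_ncard_eq]
        exact_mod_cast (by omega)

lemma IsQuotient.trans {M₁ M₂ M₃ : Matroid ℕ} (hfin : M₃.E.Finite) (h₁ : IsQuotient M₁ M₂)
    (h₂ : IsQuotient M₂ M₃) : IsQuotient M₁ M₃ :=
  isQuotient_of_closure hfin (h₁.ground_eq.trans h₂.ground_eq)
    (fun X => (h₂.closure_subset X).trans (h₁.closure_subset X))

/-! ### Lattice path matroids -/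

/-- A monotone lattice path is encoded by the set `S` of its north steps; this is the number of
north steps among its first `i` steps. -/
def height (S : Finset ℕ) (i : ℕ) : ℕ := (S.filter (· ≤ i)).card

/-- The data of a lattice path matroid on `[n] = {1, …, n}`: an upper path and a lower path with
`n` steps (given by their sets of north steps), with the same end points, the lower path never
going above the upper one. -/
@[ext] structure LPM (n : ℕ) where
  /-- the north steps of the upper path -/
  U : Finset ℕ
  /-- the north steps of the lower path -/
  L : Finset ℕ
  U_subset : U ⊆ Finset.Icc 1 n
  L_subset : L ⊆ Finset.Icc 1 n
  card_eq : U.card = L.card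
  noncrossing : ∀ i, height L i ≤ height U i

/-- The path with set of north steps `B` runs between the two paths of `M`, with the same
end points. -/
def LPM.IsBetween {n : ℕ} (M : LPM n) (B : Finset ℕ) : Prop :=
  B ⊆ Finset.Icc 1 n ∧ B.card = M.U.card ∧
    ∀ i, height M.L i ≤ height B i ∧ height B i ≤ height M.U i

lemma height_succ (S : Finset ℕ) (i : ℕ) :
    height S (i + 1) = height S i + if i + 1 ∈ S then 1 else 0 := by
  unfold height
  split_ifs with h
  · rw [← Finset.card_insert_of_notMem (a := i + 1) (s := S.filter (· ≤ i)) (by simp)]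
    congr 1
    ext a
    simp only [Finset.mem_filter, Finset.mem_insert]
    grind
  · congr 1
    ext a
    simp only [Finset.mem_filter]
    grind

lemma height_zero {n : ℕ} {S : Finset ℕ} (h : S ⊆ Finset.Icc 1 n) : height S 0 = 0 := by
  unfold height
  rw [Finset.card_eq_zero, Finset.filter_eq_empty_iff]
  intro a ha
  have := Finset.mem_Icc.1 (h ha)
  omega

lemma height_last {n : ℕ} {S : Finset ℕ} (h : S ⊆ Finset.Icc 1 n) : height S n = S.card := by
  unfold height
  rw [Finset.filter_true_of_mem]
  intro a ha
  exact (Finset.mem_Icc.1 (h ha)).2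

lemma height_exchange {S : Finset ℕ} {x y : ℕ} (hx : x ∈ S) (hy : y ∉ S) (i : ℕ) :
    height (insert y (S.erase x)) i + (if x ≤ i then 1 else 0)
      = height S i + (if y ≤ i then 1 else 0) := by
  unfold height
  rw [Finset.filter_insert, Finset.filter_erase]
  have hy' : y ∉ (S.filter (· ≤ i)).erase x := by simp [hy]
  by_cases h1 : x ≤ i
  · have h3 : x ∈ S.filter (· ≤ i) := by simp [hx, h1]
    have h4 := Finset.card_erase_add_one h3
    split_ifs
    · rw [Finset.card_insert_of_notMem hy']; omega
    · omega
  · have h3 : x ∉ S.filter (· ≤ i) := by simp [h1]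
    rw [Finset.erase_eq_of_notMem h3] at hy' ⊢
    split_ifs
    · rw [Finset.card_insert_of_notMem hy']
    · rfl

lemma eq_of_height_eq {n : ℕ} {S T : Finset ℕ} (hS : S ⊆ Finset.Icc 1 n)
    (hT : T ⊆ Finset.Icc 1 n) (h : ∀ i, height S i = height T i) : S = T := by
  ext a
  cases a with
  | zero =>
    have h1 : 0 ∉ S := fun ha => by simpa using (Finset.mem_Icc.1 (hS ha)).1
    have h2 : 0 ∉ T := fun ha => by simpa using (Finset.mem_Icc.1 (hT ha)).1
    simp [h1, h2]
  | succ i =>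
    have h1 := h (i + 1)
    rw [height_succ, height_succ, h i] at h1
    by_cases hs : i + 1 ∈ S <;> by_cases ht : i + 1 ∈ T <;> simp_all

/-- The basis exchange property for the paths between two given ones. -/
lemma LPM.exchange {n : ℕ} (M : LPM n) {B₁ B₂ : Finset ℕ} (h₁ : M.IsBetween B₁)
    (h₂ : M.IsBetween B₂) {x : ℕ} (hx₁ : x ∈ B₁) (hx₂ : x ∉ B₂) :
    ∃ y ∈ B₂, y ∉ B₁ ∧ M.IsBetween (insert y (B₁.erase x)) := by
  obtain ⟨hB₁, hc₁, hh₁⟩ := h₁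
  obtain ⟨hB₂, hc₂, hh₂⟩ := h₂
  have hx := Finset.mem_Icc.1 (hB₁ hx₁)
  have key : ∃ y ∈ B₂, y ∉ B₁ ∧
      (∀ i, x ≤ i → i < y → height B₂ i < height B₁ i) ∧
      (∀ i, y ≤ i → i < x → height B₁ i < height B₂ i) := by
    rcases Nat.lt_or_ge (height B₂ x) (height B₁ x) with hlt | hge
    · have hex : ∃ j, x ≤ j ∧ height B₁ j ≤ height B₂ j :=
        ⟨n, hx.2, by rw [height_last hB₁, height_last hB₂, hc₁, hc₂]⟩
      classical
      obtain ⟨hy1, hy2⟩ := Nat.find_spec hex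
      have hmin : ∀ i, x ≤ i → i < Nat.find hex → height B₂ i < height B₁ i := by
        intro i hi hlt'
        have := Nat.find_min hex hlt'
        push Not at this
        exact this hi
      generalize Nat.find hex = y at hy1 hy2 hmin
      obtain ⟨z, rfl⟩ : ∃ z, y = z + 1 := ⟨y - 1, by omega⟩
      have hxz : x ≤ z := by
        by_contra hcon
        have : x = z + 1 := by omega
        subst this
        omega
      have h3 := hmin z hxz (by omega)
      rw [height_succ, height_succ] at hy2
      refine ⟨z + 1, ?_, ?_, hmin, fun i h4 h5 => by omega⟩
      · by_contra hcon
        rw [if_neg hcon] at hy2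
        omega
      · intro hcon
        rw [if_pos hcon] at hy2
        split_ifs at hy2 <;> omega
    · obtain ⟨w, rfl⟩ : ∃ w, x = w + 1 := ⟨x - 1, by omega⟩
      rw [height_succ, height_succ, if_pos hx₁, if_neg hx₂] at hge
      classical
      have hP0 : height B₂ 0 ≤ height B₁ 0 := by rw [height_zero hB₁, height_zero hB₂]
      have hspec := Nat.findGreatest_spec (P := fun j => height B₂ j ≤ height B₁ j)
        (Nat.zero_le w) hP0
      have hgr : ∀ i, Nat.findGreatest (fun j => height B₂ j ≤ height B₁ j) w < i → i ≤ w →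
          height B₁ i < height B₂ i := by
        intro i h3 h4
        have := Nat.findGreatest_is_greatest h3 h4
        omega
      have hle := Nat.findGreatest_le (P := fun j => height B₂ j ≤ height B₁ j) w
      generalize Nat.findGreatest (fun j => height B₂ j ≤ height B₁ j) w = j at hspec hgr hle
      have hjw : j ≠ w := by
        rintro rfl
        omega
      have h3 := hgr (j + 1) (by omega) (by omega)
      rw [height_succ, height_succ] at h3
      refine ⟨j + 1, ?_, ?_, fun i h4 h5 => by omega, fun i h4 h5 => hgr i (by omega) (by omega)⟩
      · by_contra hcon
        rw [if_neg hcon] at h3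
        omega
      · intro hcon
        rw [if_pos hcon] at h3
        split_ifs at h3 <;> omega
  obtain ⟨y, hy₂, hy₁, hup, hdown⟩ := key
  refine ⟨y, hy₂, hy₁, ?_, ?_, ?_⟩
  · exact Finset.insert_subset (hB₂ hy₂) ((Finset.erase_subset _ _).trans hB₁)
  · rw [Finset.card_insert_of_notMem (by simp [hy₁]), Finset.card_erase_add_one hx₁, hc₁]
  · intro i
    have h3 := height_exchange hx₁ hy₁ i
    have h4 := hh₁ i
    have h5 := hh₂ i
    have h6 := hup i
    have h7 := hdown i
    split_ifs at h3 <;> omega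

lemma LPM.isBetween_U {n : ℕ} (M : LPM n) : M.IsBetween M.U :=
  ⟨M.U_subset, rfl, fun i => ⟨M.noncrossing i, le_rfl⟩⟩

lemma LPM.isBetween_L {n : ℕ} (M : LPM n) : M.IsBetween M.L :=
  ⟨M.L_subset, M.card_eq.symm, fun i => ⟨le_rfl, M.noncrossing i⟩⟩

/-- The lattice path matroid `M[U, L]` on the ground set `[n]`: its bases are the paths between
`U` and `L`. -/
def LPM.toMatroid {n : ℕ} (M : LPM n) : Matroid ℕ :=
  Matroid.ofIsBaseOfFinite (E := Set.Icc 1 n) (Set.finite_Icc 1 n)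
    (fun S => ∃ B : Finset ℕ, (B : Set ℕ) = S ∧ M.IsBetween B)
    ⟨_, M.U, rfl, M.isBetween_U⟩
    (by
      rintro _ _ ⟨B₁, rfl, h₁⟩ ⟨B₂, rfl, h₂⟩ x hx
      obtain ⟨y, hy₂, hy₁, h⟩ := M.exchange h₁ h₂ hx.1 hx.2
      exact ⟨y, ⟨hy₂, hy₁⟩, _, by simp, h⟩)
    (by
      rintro _ ⟨B, rfl, h⟩
      intro a ha
      exact Finset.mem_Icc.1 (h.1 ha))

lemma LPM.toMatroid_E {n : ℕ} (M : LPM n) : M.toMatroid.E = Set.Icc 1 n := rfl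

lemma LPM.toMatroid_isBase {n : ℕ} (M : LPM n) (S : Set ℕ) :
    M.toMatroid.IsBase S ↔ ∃ B : Finset ℕ, (B : Set ℕ) = S ∧ M.IsBetween B := Iff.rfl

lemma LPM.toMatroid_isBase_coe {n : ℕ} (M : LPM n) (B : Finset ℕ) :
    M.toMatroid.IsBase (B : Set ℕ) ↔ M.IsBetween B := by
  rw [toMatroid_isBase]
  refine ⟨?_, fun h => ⟨B, rfl, h⟩⟩
  rintro ⟨B', hB', h⟩
  rwa [Finset.coe_injective hB'] at h

/-- A lattice path matroid determines its two paths, so `LPM n` is the set of lattice path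
matroids on `[n]`. -/
lemma LPM.toMatroid_injective {n : ℕ} : Function.Injective (LPM.toMatroid (n := n)) := by
  intro M M' h
  have hb : ∀ B, M.IsBetween B ↔ M'.IsBetween B := by
    intro B
    rw [← toMatroid_isBase_coe, ← toMatroid_isBase_coe, h]
  have hU := (hb _).1 M.isBetween_U
  have hU' := (hb _).2 M'.isBetween_U
  have hL := (hb _).1 M.isBetween_L
  have hL' := (hb _).2 M'.isBetween_L
  exact LPM.ext
    (eq_of_height_eq M.U_subset M'.U_subset
      (fun i => le_antisymm (hU.2.2 i).2 (hU'.2.2 i).2))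
    (eq_of_height_eq M.L_subset M'.L_subset
      (fun i => le_antisymm (hL'.2.2 i).1 (hL.2.2 i).1))

/-! ### The quotient order -/

/-- `LPM n` with this order is the poset `𝒫ₙ`: `M' ≤ M` if and only if the matroid `M'` is a
quotient of the matroid `M`. -/
instance (n : ℕ) : PartialOrder (LPM n) where
  le M' M := IsQuotient M'.toMatroid M.toMatroid
  le_refl M := isQuotient_of_closure (Set.finite_Icc 1 n) rfl (fun _ => subset_rfl)
  le_trans _ _ _ h₁ h₂ := IsQuotient.trans (Set.finite_Icc 1 n) h₁ h₂
  le_antisymm _ _ h₁ h₂ := LPM.toMatroid_injective (Matroid.ext_closure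
    (fun X => (h₂.closure_subset X).antisymm (h₁.closure_subset X)))

/-- The least element of `𝒫ₙ` is the uniform matroid of rank `0` and the greatest one is the
uniform matroid of rank `n`. -/
instance (n : ℕ) : BoundedOrder (LPM n) where
  bot := ⟨∅, ∅, by simp, by simp, rfl, fun _ => le_rfl⟩
  bot_le M := by
    refine isQuotient_of_closure (Set.finite_Icc 1 n) rfl (fun X => ?_)
    have hb : (⟨∅, ∅, by simp, by simp, rfl, fun _ => le_rfl⟩ : LPM n).toMatroid
        = Matroid.loopyOn (Set.Icc 1 n) := by
      refine Matroid.empty_isBase_iff.1 ?_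
      simpa using (LPM.toMatroid_isBase_coe _ _).2 (LPM.isBetween_U
        (⟨∅, ∅, by simp, by simp, rfl, fun _ => le_rfl⟩ : LPM n))
    rw [hb, Matroid.loopyOn_closure_eq]
    exact M.toMatroid.closure_subset_ground X
  top := ⟨Finset.Icc 1 n, Finset.Icc 1 n, subset_rfl, subset_rfl, rfl, fun _ => le_rfl⟩
  le_top M := by
    refine isQuotient_of_closure (Set.finite_Icc 1 n) rfl (fun X => ?_)
    have hb : (⟨Finset.Icc 1 n, Finset.Icc 1 n, subset_rfl, subset_rfl, rfl,
        fun _ => le_rfl⟩ : LPM n).toMatroid = Matroid.freeOn (Set.Icc 1 n) := by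
      refine Matroid.ground_indep_iff_eq_freeOn.1 ?_
      have := ((LPM.toMatroid_isBase_coe _ _).2 (LPM.isBetween_U
        (⟨Finset.Icc 1 n, Finset.Icc 1 n, subset_rfl, subset_rfl, rfl,
          fun _ => le_rfl⟩ : LPM n))).indep
      simpa [LPM.toMatroid_E] using this
    rw [hb, Matroid.freeOn_closure_eq]
    have h := M.toMatroid.subset_closure (X ∩ M.toMatroid.E)
    rw [Matroid.closure_inter_ground, LPM.toMatroid_E] at h
    exact h

instance (n : ℕ) : Fintype (LPM n) :=
  @Fintype.ofFinite _ (Finite.of_injective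
    (fun M : LPM n => ((⟨M.U, Finset.mem_powerset.2 M.U_subset⟩,
      ⟨M.L, Finset.mem_powerset.2 M.L_subset⟩) :
        (Finset.Icc 1 n).powerset × (Finset.Icc 1 n).powerset))
    (by
      intro M M' h
      simp only [Prod.mk.injEq, Subtype.mk.injEq] at h
      exact LPM.ext h.1 h.2))

instance (n : ℕ) : DecidableEq (LPM n) := Classical.decEq _

instance (n : ℕ) : LocallyFiniteOrder (LPM n) :=
  @Fintype.toLocallyFiniteOrder _ _ _ (Classical.decRel _) (Classical.decRel _)

/-- The Möbius number `μ(𝒫ₙ) = μ(0̂, 1̂)` of the bounded poset `𝒫ₙ`. -/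
def mobiusNumber (n : ℕ) : ℤ := IncidenceAlgebra.mu ℤ (⊥ : LPM n) ⊤

/-! ### The good pair labeling and its falling chains -/

/-- The good pair label of a cover relation `M' ⋖ M`: the pair `(u, ℓ)` with `U \ U' = {u}` and
`L \ L' = {ℓ}`, where `M = M[U, L]` and `M' = M[U', L']`. On a cover relation both differences are
singletons, and `Finset.sup _ id` is the element of a singleton. The labels are ordered
by the dual of the product order. -/
def label {n : ℕ} (M' M : LPM n) : (ℕ × ℕ)ᵒᵈ :=
  OrderDual.toDual ((M.U \ M'.U).sup id, (M.L \ M'.L).sup id)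

/-- The set `ℱₙ` of the falling chains of `𝒫ₙ`: the maximal chains `0̂ = x₀ ⋖ x₁ ⋖ ⋯ ⋖ x_r = 1̂`
such that the label of `x_{i-1} ⋖ x_i` is never smaller than the label of `x_i ⋖ x_{i+1}`. -/
def fallingChains (n : ℕ) : Set (RelSeries {(a, b) : LPM n × LPM n | a ⋖ b}) :=
  {c | c.head = ⊥ ∧ c.last = ⊤ ∧ ∀ i j : Fin c.length, (i : ℕ) + 1 = j →
    ¬ label (c i.castSucc) (c i.succ) < label (c j.castSucc) (c j.succ)}

end LatticePath

end

noncomputable section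

namespace LatticePath

variable {n : ℕ}

/-! ### Heights -/

/-! The quotient order has a combinatorial form: `M' ≤ M` exactly when both step sets of `M'` lie in
those of `M` and the missing steps of the two paths, matched in increasing order, are good pairs of
`M`. A pair `(u, l)` is good if the step `u` of the upper path lies weakly above and weakly to the
left of the step `l` of the lower path. Necessity (`dominates_of_le`) tests the quotient on extremal
paths. Sufficiency (`Dominates.le`) adds one good pair at a time, each addition being a quotient by
`le_of_good`, whose core is the basis extension `exists_extension`.

Going up from `z` towards `y`, one may therefore always add the two largest missing steps. Labels
are compared in the dual product order, so iterating this gives a rising chain, and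
`up_eq_of_label_lt` makes it the only one. Moving the junction between a falling chain from `⊥` to
`z` and the rising chain from `z` to `y` is a sign-reversing involution (`isFalling_moveJunction`).
Hence the signed numbers of falling chains satisfy the recursion of the Möbius function, and `μ(⊥,
y)` is, up to the sign given by the rank, the number of falling chains from `⊥` to `y`
(`mu_bot_eq`).

For the growth, each `b` in `[n+1]` turns a falling chain of `𝒫ₙ` into one of `𝒫ₙ₊₁`: give every
upper path a last east step and every lower path an east step in position `b`, then add the cover
into `⊤`, whose label is `(n+1, b)`. Its first coordinate is larger than all earlier ones, so the
last step is not rising; `b` and the old chain can be read off. Thus `|ℱₙ₊₁| ≥ (n+1)|ℱₙ|`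
(`card_fallingTo_succ`), and `n!` follows by induction. -/

lemma height_mono (S : Finset ℕ) {i j : ℕ} (h : i ≤ j) : height S i ≤ height S j :=
  Finset.card_le_card (Finset.monotone_filter_right S fun _ _ ha => le_trans ha h)

lemma height_mono_set {S T : Finset ℕ} (h : S ⊆ T) (i : ℕ) : height S i ≤ height T i :=
  Finset.card_le_card (Finset.filter_subset_filter _ h)

lemma height_add_le (S : Finset ℕ) (i d : ℕ) : height S (i + d) ≤ height S i + d := by
  induction d with
  | zero => simp
  | succ d ih =>
    rw [← add_assoc, height_succ]
    split_ifs <;> omega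

lemma height_le_add_sub (S : Finset ℕ) {i j : ℕ} (h : i ≤ j) :
    height S j ≤ height S i + (j - i) := by
  have := height_add_le S i (j - i)
  rwa [Nat.add_sub_cancel' h] at this

lemma height_lt_of_mem {S : Finset ℕ} {p i j : ℕ} (hp : p ∈ S) (hi : i < p) (hj : p ≤ j) :
    height S i + 1 ≤ height S j := by
  obtain ⟨q, rfl⟩ : ∃ q, p = q + 1 := ⟨p - 1, by omega⟩
  have h1 := height_mono S (i := i) (j := q) (by omega)
  have h2 := height_mono S hj
  rw [height_succ, if_pos hp] at h2
  omega

lemma height_of_notMem {S : Finset ℕ} {p : ℕ} (hp : p ∉ S) (h0 : p ≠ 0) :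
    height S p = height S (p - 1) := by
  obtain ⟨q, rfl⟩ := Nat.exists_eq_succ_of_ne_zero h0
  simp [height_succ, hp]

lemma exists_notMem_of_height_lt {S : Finset ℕ} {i j : ℕ} (hij : i ≤ j)
    (h : height S j < height S i + (j - i)) : ∃ z, i < z ∧ z ≤ j ∧ z ∉ S := by
  by_contra! hcon
  have key : ∀ d, i + d ≤ j → height S (i + d) = height S i + d := by
    intro d
    induction d with
    | zero => simp
    | succ d ih =>
      intro hd
      have h1 := hcon (i + d + 1) (by omega) (by omega)
      rw [← add_assoc, height_succ, if_pos h1, ih (by omega)]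
      rfl
  have := key (j - i) (by omega)
  rw [Nat.add_sub_cancel' hij] at this
  omega

lemma height_insert {S : Finset ℕ} {z : ℕ} (hz : z ∉ S) (i : ℕ) :
    height (insert z S) i = height S i + if z ≤ i then 1 else 0 := by
  unfold height
  rw [Finset.filter_insert]
  split_ifs
  · rw [Finset.card_insert_of_notMem (by simp [hz])]
  · rfl

lemma height_erase {S : Finset ℕ} {z : ℕ} (hz : z ∈ S) (i : ℕ) :
    height (S.erase z) i + (if z ≤ i then 1 else 0) = height S i := by
  rw [← height_insert (Finset.notMem_erase z S), Finset.insert_erase hz]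

lemma height_sdiff {S T : Finset ℕ} (h : T ⊆ S) (i : ℕ) :
    height (S \ T) i + height T i = height S i := by
  unfold height
  rw [← Finset.card_union_of_disjoint, ← Finset.filter_union, Finset.sdiff_union_of_subset h]
  exact Finset.disjoint_filter_filter Finset.sdiff_disjoint

lemma height_le_card (S : Finset ℕ) (i : ℕ) : height S i ≤ S.card := Finset.card_filter_le _ _

lemma height_of_ge {n : ℕ} {S : Finset ℕ} (h : S ⊆ Finset.Icc 1 n) {i : ℕ} (hi : n ≤ i) :
    height S i = S.card :=
  le_antisymm (height_le_card S i) (height_last h ▸ height_mono S hi)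

/-- A function growing by steps of size at most one is the height function of a set. -/
lemma exists_height_eq (n : ℕ) (g : ℕ → ℕ) (h0 : g 0 = 0)
    (hg : ∀ i, g i ≤ g (i + 1) ∧ g (i + 1) ≤ g i + 1) :
    ∃ S ⊆ Finset.Icc 1 n, ∀ i ≤ n, height S i = g i := by
  refine ⟨(Finset.Icc 1 n).filter (fun i => g (i - 1) < g i), Finset.filter_subset _ _, ?_⟩
  intro i
  induction i with
  | zero =>
    intro _
    rw [height_zero (Finset.filter_subset _ _), h0]
  | succ i ih =>
    intro hi
    have := hg i
    rw [height_succ, ih (by omega)]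
    simp only [Finset.mem_filter, Finset.mem_Icc, Nat.add_sub_cancel]
    split_ifs <;> omega

/-! ### Bases and closures of lattice path matroids -/

lemma LPM.isBetween_of_le (M : LPM n) {B : Finset ℕ} (hB : B ⊆ Finset.Icc 1 n)
    (h : ∀ i ≤ n, height M.L i ≤ height B i ∧ height B i ≤ height M.U i) : M.IsBetween B := by
  have hc : B.card = M.U.card := by
    -- At `i = n` both bounds are the common number of north steps, which forces the cardinality of
    -- `B`.
    have := h n le_rfl
    rw [height_last hB, height_last M.U_subset, height_last M.L_subset, ← M.card_eq] at this
    omega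
  refine ⟨hB, hc, fun i => ?_⟩
  rcases le_total i n with hi | hi
  · exact h i hi
  · rw [height_of_ge hB hi, height_of_ge M.L_subset hi, height_of_ge M.U_subset hi, hc, M.card_eq]
    simp

lemma LPM.exists_isBetween_of_indep (M : LPM n) {I : Set ℕ} (h : M.toMatroid.Indep I) :
    ∃ B : Finset ℕ, M.IsBetween B ∧ I ⊆ B := by
  obtain ⟨B, hB, hI⟩ := h.exists_isBase_superset
  obtain ⟨B, rfl, hB'⟩ := (M.toMatroid_isBase B).1 hB
  exact ⟨B, hB', hI⟩

lemma LPM.IsBetween.isBase {M : LPM n} {B : Finset ℕ} (h : M.IsBetween B) :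
    M.toMatroid.IsBase B := (M.toMatroid_isBase_coe B).2 h

lemma LPM.IsBetween.indep {M : LPM n} {B : Finset ℕ} (h : M.IsBetween B) {I : Set ℕ}
    (hI : I ⊆ B) : M.toMatroid.Indep I := h.isBase.indep.subset hI

lemma LPM.IsBetween.height_zero {M : LPM n} {B : Finset ℕ} (h : M.IsBetween B) : height B 0 = 0 :=
  LatticePath.height_zero h.1

lemma height_filter_le (S : Finset ℕ) {m i : ℕ} (h : i ≤ m) :
    height (S.filter (· ≤ m)) i = height S i := by
  unfold height
  rw [Finset.filter_filter]
  congr 1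
  ext a
  simp only [Finset.mem_filter]
  exact and_congr_right fun _ => ⟨fun h => h.2, fun h' => ⟨h'.trans h, h'⟩⟩

lemma mem_closure_iff_of_mem_ground {M : Matroid ℕ} {I : Set ℕ} (hI : M.Indep I) {q : ℕ}
    (hq : q ∈ M.E) : q ∈ M.closure I ↔ (M.Indep (insert q I) → q ∈ I) := by
  rw [hI.mem_closure_iff']
  exact and_iff_right hq

/-- The north steps of the upper path span the initial segments. -/
lemma LPM.mem_closure_prefix (M : LPM n) {q m m' : ℕ} (hq : q ∈ Finset.Icc 1 n) (hqm : q ≤ m')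
    (hm : m ≤ m') (hh : height M.U m' = height M.U m) :
    q ∈ M.toMatroid.closure (M.U.filter (· ≤ m) : Finset ℕ) := by
  have hI : M.toMatroid.Indep (M.U.filter (· ≤ m) : Finset ℕ) :=
    M.isBetween_U.indep (Finset.coe_subset.2 (Finset.filter_subset _ _))
  rw [mem_closure_iff_of_mem_ground hI (by simpa [LPM.toMatroid_E] using hq)]
  intro hins
  by_contra hcon
  obtain ⟨B, hB, hsub⟩ := M.exists_isBetween_of_indep hins
  rw [← Finset.coe_insert, Finset.coe_subset] at hsub
  -- A basis containing the prefix and `q` would be above the upper path at `m'`.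
  have h1 := height_mono_set hsub m'
  rw [height_insert (by simpa using hcon), if_pos hqm] at h1
  have h2 := height_mono (M.U.filter (· ≤ m)) hm
  rw [height_filter_le _ le_rfl] at h2
  have h3 := (hB.2.2 m').2
  omega

lemma card_filter_lt_add_height (S : Finset ℕ) (m : ℕ) :
    (S.filter (m < ·)).card + height S m = S.card := by
  have := Finset.card_filter_add_card_filter_not (s := S) (fun a => m < a)
  simpa [height] using this

/-- The north steps of the lower path span the final segments. -/
lemma LPM.mem_closure_suffix (M : LPM n) {q m m' : ℕ} (hq : q ∈ Finset.Icc 1 n) (hqm : m' < q)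
    (hm : m' ≤ m) (hh : height M.L m' = height M.L m) :
    q ∈ M.toMatroid.closure (M.L.filter (m < ·) : Finset ℕ) := by
  have hI : M.toMatroid.Indep (M.L.filter (m < ·) : Finset ℕ) :=
    M.isBetween_L.indep (Finset.coe_subset.2 (Finset.filter_subset _ _))
  rw [mem_closure_iff_of_mem_ground hI (by simpa [LPM.toMatroid_E] using hq)]
  intro hins
  by_contra hcon
  obtain ⟨B, hB, hsub⟩ := M.exists_isBetween_of_indep hins
  rw [← Finset.coe_insert, Finset.coe_subset] at hsub
  have h1 : insert q (M.L.filter (m < ·)) ⊆ B.filter (m' < ·) := by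
    intro a ha
    refine Finset.mem_filter.2 ⟨hsub ha, ?_⟩
    rcases Finset.mem_insert.1 ha with rfl | ha
    · exact hqm
    · exact lt_of_le_of_lt hm (Finset.mem_filter.1 ha).2
  have h2 := Finset.card_le_card h1
  rw [Finset.card_insert_of_notMem (by simpa using hcon)] at h2
  have h3 := card_filter_lt_add_height M.L m
  have h4 := card_filter_lt_add_height B m'
  have h5 := (hB.2.2 m').1
  have h6 := hB.2.1
  have h7 := M.card_eq
  omega

/-! ### Consequences of the quotient relation -/

lemma LPM.closure_subset_of_le {M' M : LPM n} (h : M' ≤ M) (X : Set ℕ) :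
    M.toMatroid.closure X ⊆ M'.toMatroid.closure X :=
  IsQuotient.closure_subset h X

/-- If `p ∈ M'.U` were not in `M.U`, the upper path of `M` would not rise at `p`, so the earlier
steps of `M.U` would span `p` in `M`, hence in `M'`. In `M'` those earlier elements are spanned by
the steps of `M'.U` before `p`, which are independent together with `p`. -/
lemma LPM.U_subset_of_le {M' M : LPM n} (h : M' ≤ M) : M'.U ⊆ M.U := by
  intro p hp'
  by_contra hp
  have hpI := M'.U_subset hp'
  have hp1 := Finset.mem_Icc.1 hpI
  have h1 := M.mem_closure_prefix (m := p - 1) hpI le_rfl (by omega)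
    (height_of_notMem hp (by omega))
  have h2 : ((M.U.filter (· ≤ p - 1) : Finset ℕ) : Set ℕ) ⊆
      M'.toMatroid.closure (M'.U.filter (· ≤ p - 1) : Finset ℕ) := by
    intro q hq
    simp only [Finset.coe_filter, Set.mem_ofPred_eq] at hq
    exact M'.mem_closure_prefix (M.U_subset hq.1) hq.2 le_rfl rfl
  have h3 := M'.toMatroid.closure_subset_closure_of_subset_closure h2
    (LPM.closure_subset_of_le h _ h1)
  have hI : M'.toMatroid.Indep (M'.U.filter (· ≤ p - 1) : Finset ℕ) :=
    M'.isBetween_U.indep (Finset.coe_subset.2 (Finset.filter_subset _ _))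
  rw [mem_closure_iff_of_mem_ground hI (by simpa [LPM.toMatroid_E] using hpI)] at h3
  have h4 := h3 (by
    refine M'.isBetween_U.indep (Set.insert_subset hp' ?_)
    exact (Finset.coe_subset.2 (Finset.filter_subset _ _)))
  simp at h4
  omega

/-- The mirror image of `U_subset_of_le`: lower paths and final segments replace upper paths and
initial ones. -/
lemma LPM.L_subset_of_le {M' M : LPM n} (h : M' ≤ M) : M'.L ⊆ M.L := by
  intro p hp'
  by_contra hp
  have hpI := M'.L_subset hp'
  have hp1 := Finset.mem_Icc.1 hpI
  have h1 := M.mem_closure_suffix (m := p) (m' := p - 1) hpI (by omega) (by omega)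
    (height_of_notMem hp (by omega)).symm
  have h2 : ((M.L.filter (p < ·) : Finset ℕ) : Set ℕ) ⊆
      M'.toMatroid.closure (M'.L.filter (p < ·) : Finset ℕ) := by
    intro q hq
    simp only [Finset.coe_filter, Set.mem_ofPred_eq] at hq
    exact M'.mem_closure_suffix (M.L_subset hq.1) hq.2 le_rfl rfl
  have h3 := M'.toMatroid.closure_subset_closure_of_subset_closure h2
    (LPM.closure_subset_of_le h _ h1)
  have hI : M'.toMatroid.Indep (M'.L.filter (p < ·) : Finset ℕ) :=
    M'.isBetween_L.indep (Finset.coe_subset.2 (Finset.filter_subset _ _))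
  rw [mem_closure_iff_of_mem_ground hI (by simpa [LPM.toMatroid_E] using hpI)] at h3
  have h4 := h3 (by
    refine M'.isBetween_L.indep (Set.insert_subset hp' ?_)
    exact (Finset.coe_subset.2 (Finset.filter_subset _ _)))
  simp at h4

lemma LPM.exists_base_superset_of_le {M' M : LPM n} (h : M' ≤ M) {B' : Finset ℕ}
    (hB' : M'.IsBetween B') : ∃ B, M.IsBetween B ∧ B' ⊆ B := by
  have hind : M.toMatroid.Indep B' := by
    have hI := hB'.isBase.indep
    have hg : (B' : Set ℕ) ⊆ M.toMatroid.E := hI.subset_ground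
    rw [Matroid.indep_iff_forall_notMem_closure_sdiff hg]
    intro e he hc
    exact (Matroid.indep_iff_forall_notMem_closure_sdiff hI.subset_ground).1 hI he
      (LPM.closure_subset_of_le h _ hc)
  obtain ⟨B, hB, hsub⟩ := M.exists_isBetween_of_indep hind
  exact ⟨B, hB, Finset.coe_subset.1 hsub⟩

lemma LPM.exists_base_subset_of_le {M' M : LPM n} (h : M' ≤ M) {B : Finset ℕ}
    (hB : M.IsBetween B) : ∃ B', M'.IsBetween B' ∧ B' ⊆ B := by
  have hg : (B : Set ℕ) ⊆ M'.toMatroid.E := hB.isBase.subset_ground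
  have hsp : M'.toMatroid.Spanning B := by
    rw [Matroid.spanning_iff_ground_subset_closure hg]
    refine subset_trans ?_ (LPM.closure_subset_of_le h B)
    rw [hB.isBase.closure_eq]
    exact subset_rfl
  obtain ⟨S, hS, hSB⟩ := hsp.exists_isBase_subset
  obtain ⟨B', rfl, hB'⟩ := (M'.toMatroid_isBase S).1 hS
  exact ⟨B', hB', Finset.coe_subset.1 hSB⟩

/-! ### Good pairs give quotients -/

lemma exists_last_before {P : ℕ → Prop} {p : ℕ} (hp : 0 < p) (h0 : P 0) :
    ∃ m, m < p ∧ P m ∧ ∀ i, m < i → i < p → ¬ P i := by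
  classical
  refine ⟨Nat.findGreatest P (p - 1), ?_, Nat.findGreatest_spec (Nat.zero_le _) h0, ?_⟩
  · have := Nat.findGreatest_le (P := P) (p - 1)
    omega
  · intro i h1 h2
    exact Nat.findGreatest_is_greatest h1 (by omega)

lemma exists_first_from {P : ℕ → Prop} {p N : ℕ} (hp : p ≤ N) (hN : P N) :
    ∃ m, p ≤ m ∧ m ≤ N ∧ P m ∧ ∀ i, p ≤ i → i < m → ¬ P i := by
  classical
  have hex : ∃ m, p ≤ m ∧ P m := ⟨N, hp, hN⟩
  obtain ⟨h1, h2⟩ := Nat.find_spec hex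
  exact ⟨Nat.find hex, h1, Nat.find_min' hex ⟨hp, hN⟩, h2,
    fun i h3 h4 h5 => Nat.find_min hex h4 ⟨h3, h5⟩⟩

/-- If `M` arises from `M'` by adding the steps of a good pair, then each basis of `M'` extends to a
basis of `M` whose exchanges for a given element are exchanges of the smaller basis. -/
lemma LPM.exists_extension {M' M : LPM n} {u l : ℕ} (hu : u ∉ M'.U) (hl : l ∉ M'.L)
    (hU : M.U = insert u M'.U) (hL : M.L = insert l M'.L)
    (hN : height M.L l ≤ height M.U u) (hE : u + height M.L l ≤ l + height M.U u)
    {B' : Finset ℕ} (hB' : M'.IsBetween B') {p : ℕ} (hp : p ∈ B') :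
    ∃ B, M.IsBetween B ∧ B' ⊆ B ∧ ∀ t ∉ B, M.IsBetween (insert t (B.erase p)) →
      M'.IsBetween (insert t (B'.erase p)) := by
  have hu1 := Finset.mem_Icc.1 (M.U_subset (hU ▸ Finset.mem_insert_self _ _))
  have hl1 := Finset.mem_Icc.1 (M.L_subset (hL ▸ Finset.mem_insert_self _ _))
  have hp1 := Finset.mem_Icc.1 (hB'.1 hp)
  have hhU : ∀ i, height M.U i = height M'.U i + if u ≤ i then 1 else 0 := fun i => by
    rw [hU, height_insert hu]
  have hhL : ∀ i, height M.L i = height M'.L i + if l ≤ i then 1 else 0 := fun i => by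
    rw [hL, height_insert hl]
  have hb := hB'.2.2
  have h0 : height B' 0 = height M'.U 0 := by rw [hB'.height_zero, height_zero M'.U_subset]
  have hn : height B' n = height M'.L n := by
    rw [height_last hB'.1, height_last M'.L_subset, hB'.2.1, M'.card_eq]
  -- `b` and `α` are the last contacts of `B'` with the upper path before `u` and `p`; `a` and `β`
  -- are the first contacts with the lower path from `l` and `p` on. Inserting `z ∉ B'` stays
  -- between the paths of `M` if `b < z ≤ a`. In `M'`, replacing `p` by `t` is allowed if `α < t ≤
  -- β`.
  obtain ⟨b, hbu, hbt, hbm⟩ := exists_last_before (P := fun i => height B' i = height M'.U i)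
    (p := u) (by omega) h0
  obtain ⟨a, hla, han, hat, ham⟩ := exists_first_from (P := fun i => height B' i = height M'.L i)
    hl1.2 hn
  obtain ⟨α, hαp, hαt, hαm⟩ := exists_last_before (P := fun i => height B' i = height M'.U i)
    (p := p) (by omega) h0
  obtain ⟨β, hpβ, hβn, hβt, hβm⟩ := exists_first_from
    (P := fun i => height B' i = height M'.L i) hp1.2 hn
  -- the two constraints coming from the exchanges exclude each other
  have hexcl : ¬ (u ≤ α ∧ β < l) := by
    rintro ⟨h1, h2⟩
    have h3 := hhU α
    have h4 := hhL β
    have h5 := height_lt_of_mem hp hαp hpβ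
    have h6 := height_mono M.U h1
    have h7 := height_lt_of_mem (S := M.L) (hL ▸ Finset.mem_insert_self _ _) h2 le_rfl
    rw [if_pos h1] at h3
    rw [if_neg (by omega)] at h4
    omega
  -- Otherwise `l ≤ a ≤ b < u`. Counting east steps along `B'` from `a` to `b` would give the upper
  -- path more of them before `u` than the lower path has before `l`, against `hE`.
  have hba : b < a := by
    by_contra hcon
    have h1 := hhU b
    have h2 := hhL a
    rw [if_neg (by omega)] at h1
    rw [if_pos hla] at h2
    have h3 := height_le_add_sub B' (i := a) (j := b) (by omega)
    have h4 := height_le_add_sub M.L (i := l) (j := a) hla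
    have h5 := height_le_add_sub M.U (i := b) (j := u - 1) (by omega)
    have h6 := height_lt_of_mem (S := M.U) (i := u - 1) (hU ▸ Finset.mem_insert_self _ _)
      (by omega) (le_refl u)
    have h7 := height_le_add_sub M.U (i := u - 1) (j := u) (by omega)
    omega
  -- The last two conditions keep the room gained at `u` or `l` from permitting new exchanges: `z`
  -- uses up the extra height at `α`, and gives no extra height at `β`. In each case the contacts at
  -- the ends of an interval make `B'` rise by less than its length, so it has an east step there.
  obtain ⟨z, hbz, hza, hzB, hzα, hzβ⟩ : ∃ z, b < z ∧ z ≤ a ∧ z ∉ B' ∧ (u ≤ α → z ≤ α) ∧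
      (β < l → β < z) := by
    by_cases h1 : u ≤ α ∧ α < a
    · obtain ⟨z, hz1, hz2, hz3⟩ := exists_notMem_of_height_lt (S := B') (i := b) (j := α)
        (by omega) (by
          have h2 := hhU b
          have h3 := hhU α
          rw [if_neg (by omega)] at h2
          rw [if_pos h1.1] at h3
          have := height_le_add_sub M.U (i := b) (j := α) (by omega)
          omega)
      exact ⟨z, hz1, by omega, hz3, fun _ => hz2, fun h => absurd ⟨h1.1, h⟩ hexcl⟩
    · by_cases h2 : β < l ∧ b < β
      · obtain ⟨z, hz1, hz2, hz3⟩ := exists_notMem_of_height_lt (S := B') (i := β) (j := a)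
          (by omega) (by
            have h3 := hhL β
            have h4 := hhL a
            rw [if_neg (by omega)] at h3
            rw [if_pos hla] at h4
            have := height_le_add_sub M.L (i := β) (j := a) (by omega)
            omega)
        exact ⟨z, by omega, hz2, hz3, fun h => absurd ⟨h, h2.1⟩ hexcl, fun _ => hz1⟩
      · obtain ⟨z, hz1, hz2, hz3⟩ := exists_notMem_of_height_lt (S := B') (i := b) (j := a)
          (by omega) (by
            have h3 := hhU b
            have h4 := hhL a
            rw [if_neg (by omega)] at h3
            rw [if_pos hla] at h4
            have := height_le_add_sub M.L (i := b) (j := a) (by omega)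
            have := M.noncrossing b
            omega)
        exact ⟨z, hz1, hz2, hz3, fun h => by omega, fun h => by omega⟩
  have hz0 : z ≠ 0 := by omega
  have hB : M.IsBetween (insert z B') := by
    refine M.isBetween_of_le (Finset.insert_subset (Finset.mem_Icc.2 ⟨by omega, by omega⟩) hB'.1)
      fun i _ => ?_
    rw [height_insert hzB, hhU, hhL]
    have h1 := hb i
    have h2 := hbm i
    have h3 := ham i
    split_ifs <;> omega
  refine ⟨insert z B', hB, Finset.subset_insert _ _, fun t ht h => ?_⟩
  have htn : t ∈ Finset.Icc 1 n := h.1 (Finset.mem_insert_self _ _)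
  have htB : t ∉ B' := fun h' => ht (Finset.mem_insert_of_mem h')
  have key : ∀ i, height (insert t ((insert z B').erase p)) i + (if p ≤ i then 1 else 0)
      = height B' i + (if z ≤ i then 1 else 0) + (if t ≤ i then 1 else 0) := fun i => by
    rw [height_exchange (Finset.mem_insert_of_mem hp) ht, height_insert hzB]
  refine M'.isBetween_of_le (Finset.insert_subset htn ((Finset.erase_subset _ _).trans hB'.1))
    fun i _ => ?_
  have h1 := height_exchange hp htB i
  have h2 := hb i
  have h3 := hαm i
  have h4 := hβm i
  have h5 := key α
  have h6 := key β
  have h7 := (h.2.2 α).2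
  have h8 := (h.2.2 β).1
  rw [hhU] at h7
  rw [hhL] at h8
  rw [if_neg (by omega)] at h5
  rw [if_pos hpβ] at h6
  -- A violation in `M'` at `i` would put `t` beyond the contact `β` (lower bound) or not beyond `α`
  -- (upper bound). The assumed exchange in `M`, evaluated at that contact, contradicts the choice
  -- of `z`.
  constructor
  · by_contra hcon
    have hpi : p ≤ i := by
      by_contra hpi
      rw [if_neg hpi] at h1
      omega
    rw [if_pos hpi] at h1
    have hti : ¬ t ≤ i := by
      intro hti
      rw [if_pos hti] at h1
      omega
    rw [if_neg hti] at h1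
    have hβi : β ≤ i := by
      by_contra hβi
      exact h4 hpi (by omega) (show height B' i = height M'.L i by omega)
    rw [if_neg (show ¬ t ≤ β by omega)] at h6
    clear h1 h2 h3 h4 h5 h7
    split_ifs at h6 h8 <;> omega
  · by_contra hcon
    have hti : t ≤ i := by
      by_contra hti
      rw [if_neg hti] at h1
      omega
    rw [if_pos hti] at h1
    have hpi : ¬ p ≤ i := by
      intro hpi
      rw [if_pos hpi] at h1
      omega
    rw [if_neg hpi] at h1
    have hiα : i ≤ α := by
      by_contra hiα
      exact h3 (by omega) (by omega) (show height B' i = height M'.U i by omega)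
    rw [if_pos (hti.trans hiα)] at h5
    clear h1 h2 h3 h4 h6 h8
    split_ifs at h5 h7 <;> omega

/-- Removing the steps of a good pair gives a quotient. -/
lemma LPM.le_of_good {M' M : LPM n} {u l : ℕ} (hu : u ∉ M'.U) (hl : l ∉ M'.L)
    (hU : M.U = insert u M'.U) (hL : M.L = insert l M'.L)
    (hN : height M.L l ≤ height M.U u) (hE : u + height M.L l ≤ l + height M.U u) : M' ≤ M := by
  refine isQuotient_of_closure (Set.finite_Icc 1 n) rfl fun X x hx => ?_
  by_contra hx'
  have hxE : x ∈ M.toMatroid.E := Matroid.mem_ground_of_mem_closure hx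
  obtain ⟨Y, hY⟩ := M'.toMatroid.exists_isBasis' X
  rw [← hY.closure_eq_closure, hY.indep.notMem_closure_iff hxE] at hx'
  obtain ⟨B', hB', hsub⟩ := M'.exists_isBetween_of_indep hx'.1
  have hxB' : x ∈ B' := hsub (Set.mem_insert _ _)
  obtain ⟨B, hB, hBB, hex⟩ := LPM.exists_extension hu hl hU hL hN hE hB' hxB'
  have hYB : Y ⊆ (B' : Set ℕ) \ {x} := fun y hy =>
    ⟨hsub (Set.mem_insert_of_mem _ hy), by rintro rfl; exact hx'.2 hy⟩
  have hxcl' : x ∉ M'.toMatroid.closure ((B' : Set ℕ) \ {x}) :=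
    (Matroid.indep_iff_forall_notMem_closure_sdiff hB'.isBase.indep.subset_ground).1
      hB'.isBase.indep hxB'
  have hxcl : x ∉ M.toMatroid.closure ((B : Set ℕ) \ {x}) :=
    (Matroid.indep_iff_forall_notMem_closure_sdiff hB.isBase.indep.subset_ground).1
      hB.isBase.indep (hBB hxB')
  -- It suffices that `B \ {x}` spans `X` in `M`. A `y ∈ X` outside its closure could replace `x` in
  -- `B`, hence in `B'`, although `B' \ {x}` contains `Y` and so spans `y` in `M'`.
  refine hxcl ?_
  rw [← Matroid.closure_inter_ground] at hx
  refine M.toMatroid.closure_subset_closure_of_subset_closure (fun y hy => ?_) hx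
  have hyE : y ∈ M'.toMatroid.E := hy.2
  have hycl : y ∈ M'.toMatroid.closure ((B' : Set ℕ) \ {x}) := by
    refine M'.toMatroid.closure_subset_closure hYB ?_
    rw [hY.closure_eq_closure]
    exact M'.toMatroid.mem_closure_of_mem' hy.1 hyE
  have hyx : y ≠ x := by rintro rfl; exact hxcl' hycl
  have hsubE : (B : Set ℕ) \ {x} ⊆ M.toMatroid.E :=
    sdiff_subset.trans hB.isBase.subset_ground
  by_cases hyB : y ∈ B
  · exact M.toMatroid.mem_closure_of_mem ⟨hyB, hyx⟩ hsubE
  · by_contra hycl2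
    have hI : M.toMatroid.Indep ((B : Set ℕ) \ {x}) := hB.isBase.indep.subset sdiff_subset
    rw [hI.notMem_closure_iff hy.2] at hycl2
    have hbase := hB.isBase.exchange_isBase_of_indep hyB hycl2.1
    rw [← Finset.coe_erase, ← Finset.coe_insert, LPM.toMatroid_isBase_coe] at hbase
    have h2 := (hex y hyB hbase).isBase
    rw [Finset.coe_insert, Finset.coe_erase] at h2
    have hyB' : y ∉ (B' : Set ℕ) \ {x} := fun h => hyB (hBB h.1)
    have hI' : M'.toMatroid.Indep ((B' : Set ℕ) \ {x}) := hB'.isBase.indep.subset sdiff_subset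
    exact (hI'.notMem_closure_iff hyE).2 ⟨h2.indep, hyB'⟩ hycl

/-! ### The combinatorial description of the order -/

/-- The steps in which the paths of `M` exceed those of `M'`, matched in increasing order, are good
pairs of `M`. -/
def LPM.Dominates (M' M : LPM n) : Prop :=
  M'.U ⊆ M.U ∧ M'.L ⊆ M.L ∧ ∀ u ∈ M.U \ M'.U, ∀ l ∈ M.L \ M'.L,
    height (M.U \ M'.U) u = height (M.L \ M'.L) l →
      height M.L l ≤ height M.U u ∧ u + height M.L l ≤ l + height M.U u

/-- If a matched pair is not good, an extremal path has no room. For nested bases `B' ⊆ B` of the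
two matroids, the height of `B \ B'` cannot decrease, yet the bounds at two places would force it to
drop. -/
lemma LPM.dominates_of_le {M' M : LPM n} (h : M' ≤ M) : M'.Dominates M := by
  have hU := LPM.U_subset_of_le h
  have hL := LPM.L_subset_of_le h
  refine ⟨hU, hL, fun u hu l hl hs => ?_⟩
  rw [Finset.mem_sdiff] at hu hl
  have hu1 := Finset.mem_Icc.1 (M.U_subset hu.1)
  have hl1 := Finset.mem_Icc.1 (M.L_subset hl.1)
  have eU := height_sdiff hU u
  have eL := height_sdiff hL l
  have gU := height_of_notMem hu.2 (by omega)
  have gL := height_of_notMem hl.2 (by omega)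
  have fU : height M.U u = height M.U (u - 1) + 1 := by
    have h1 := height_lt_of_mem hu.1 (i := u - 1) (by omega) le_rfl
    have h2 := height_le_add_sub M.U (i := u - 1) (j := u) (by omega)
    omega
  have fL : height M.L l = height M.L (l - 1) + 1 := by
    have h1 := height_lt_of_mem hl.1 (i := l - 1) (by omega) le_rfl
    have h2 := height_le_add_sub M.L (i := l - 1) (j := l) (by omega)
    omega
  constructor
  · by_contra hcon
    have hul : u < l := by
      by_contra hlu
      have := height_mono M.L (i := l) (j := u) (by omega)
      have := M.noncrossing u
      omega
    -- The path follows the upper path of `M` up to `u`, goes east until it meets the lower path,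
    -- then follows that. With `s` the common rank of `u` and `l` among the missing steps, `B \ B'`
    -- has height at least `s` at `u` and at most `s - 1` at `l - 1`.
    obtain ⟨B, hBn, hB⟩ := exists_height_eq n
      (fun i => if i ≤ u then height M.U i else max (height M.L i) (height M.U u))
      (by simp [height_zero M.U_subset]) (by
        intro i
        have h1 := height_mono M.U (i := i) (j := i + 1) (by omega)
        have h2 := height_le_add_sub M.U (i := i) (j := i + 1) (by omega)
        have h3 := height_mono M.L (i := i) (j := i + 1) (by omega)
        have h4 := height_le_add_sub M.L (i := i) (j := i + 1) (by omega)
        have h5 := M.noncrossing i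
        rcases Nat.lt_trichotomy i u with h6 | h6 | h6
        · rw [if_pos (by omega), if_pos (by omega)]; omega
        · subst h6; rw [if_pos (by omega), if_neg (by omega)]; omega
        · rw [if_neg (by omega), if_neg (by omega)]; omega)
    have hBM : M.IsBetween B := by
      refine M.isBetween_of_le hBn fun i hi => ?_
      rw [hB i hi]
      have h5 := M.noncrossing i
      split_ifs with h6
      · omega
      · have := height_mono M.U (i := u) (j := i) (by omega)
        omega
    obtain ⟨B', hB', hsub⟩ := LPM.exists_base_subset_of_le h hBM
    have h1 := hB u (by omega)
    have h2 := hB (l - 1) (by omega)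
    rw [if_pos le_rfl] at h1
    have h3 : height B (l - 1) = height M.L (l - 1) := by
      rcases Nat.lt_or_ge u (l - 1) with h6 | h6
      · rw [h2, if_neg (by omega)]; omega
      · have : l - 1 = u := by omega
        have h7 := M.noncrossing u
        rw [this] at fL ⊢
        rw [h1]
        omega
    have h4 := height_sdiff hsub u
    have h5 := height_sdiff hsub (l - 1)
    have h6 := height_mono (B \ B') (i := u) (j := l - 1) (by omega)
    have h7 := (hB'.2.2 u).2
    have h8 := (hB'.2.2 (l - 1)).1
    omega
  · by_contra hcon
    have hlu : l < u := by
      by_contra hlu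
      have h1 := height_le_add_sub M.L (i := u) (j := l) (by omega)
      have := M.noncrossing u
      omega
    -- Dually, a path of `M'` follows its lower path up to `l`, goes north until it meets the upper
    -- path, then follows that. The drop of `B \ B'` now occurs between `l` and `u - 1`.
    obtain ⟨B', hBn, hB⟩ := exists_height_eq n
      (fun i => if i ≤ l then height M'.L i else min (height M'.U i) (height M'.L l + (i - l)))
      (by simp [height_zero M'.L_subset]) (by
        intro i
        have h1 := height_mono M'.U (i := i) (j := i + 1) (by omega)
        have h2 := height_le_add_sub M'.U (i := i) (j := i + 1) (by omega)
        have h3 := height_mono M'.L (i := i) (j := i + 1) (by omega)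
        have h4 := height_le_add_sub M'.L (i := i) (j := i + 1) (by omega)
        have h5 := M'.noncrossing i
        rcases Nat.lt_trichotomy i l with h6 | h6 | h6
        · rw [if_pos (by omega), if_pos (by omega)]; omega
        · subst h6; rw [if_pos (by omega), if_neg (by omega)]; omega
        · rw [if_neg (by omega), if_neg (by omega)]; omega)
    have hBM : M'.IsBetween B' := by
      refine M'.isBetween_of_le hBn fun i hi => ?_
      rw [hB i hi]
      have h5 := M'.noncrossing i
      split_ifs with h6
      · omega
      · have := height_le_add_sub M'.L (i := l) (j := i) (by omega)
        omega
    obtain ⟨B, hB', hsub⟩ := LPM.exists_base_superset_of_le h hBM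
    have h1 := hB l (by omega)
    have h2 := hB (u - 1) (by omega)
    rw [if_pos le_rfl] at h1
    have h3 : height B' (u - 1) = min (height M'.U (u - 1)) (height M'.L l + (u - 1 - l)) := by
      rcases Nat.lt_or_ge l (u - 1) with h6 | h6
      · rw [h2, if_neg (by omega)]
      · have : u - 1 = l := by omega
        have h7 := M'.noncrossing l
        rw [this, h1]
        omega
    have h4 := height_sdiff hsub l
    have h5 := height_sdiff hsub (u - 1)
    have h6 := height_mono (B \ B') (i := l) (j := u - 1) (by omega)
    have h7 := (hB'.2.2 (u - 1)).2
    have h8 := (hB'.2.2 l).1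
    omega

/-! ### Building a comparison by adding the largest missing steps -/

/-- The largest north step of the upper path of `y` that is missing in `z`. -/
def maxU (z y : LPM n) : ℕ := (y.U \ z.U).sup id

/-- The largest north step of the lower path of `y` that is missing in `z`. -/
def maxL (z y : LPM n) : ℕ := (y.L \ z.L).sup id

lemma label_eq (z y : LPM n) : label z y = OrderDual.toDual (maxU z y, maxL z y) := rfl

lemma sup_id_mem {S : Finset ℕ} (h : S.Nonempty) : S.sup id ∈ S := by
  obtain ⟨a, ha, h'⟩ := Finset.exists_mem_eq_sup S h id
  rw [h']
  exact ha

lemma height_sup_id (S : Finset ℕ) : height S (S.sup id) = S.card := by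
  unfold height
  rw [Finset.filter_true_of_mem]
  intro a ha
  exact Finset.le_sup (f := id) ha

lemma LPM.Dominates.card_sdiff {z y : LPM n} (h : z.Dominates y) :
    (y.U \ z.U).card = (y.L \ z.L).card := by
  rw [Finset.card_sdiff_of_subset h.1, Finset.card_sdiff_of_subset h.2.1, y.card_eq, z.card_eq]

lemma LPM.Dominates.card_pos {z y : LPM n} (h : z.Dominates y) (hne : z ≠ y) :
    0 < (y.U \ z.U).card := by
  rw [Nat.pos_iff_ne_zero]
  intro h0
  have h1 := h.card_sdiff
  rw [h0, eq_comm, Finset.card_eq_zero, Finset.sdiff_eq_empty_iff_subset] at h1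
  rw [Finset.card_eq_zero, Finset.sdiff_eq_empty_iff_subset] at h0
  exact hne (LPM.ext (h.1.antisymm h0) (h.2.1.antisymm h1))

lemma height_erase_of_lt {S : Finset ℕ} {i m : ℕ} (h : i < m) :
    height (S.erase m) i = height S i := by
  by_cases hm : m ∈ S
  · have := height_erase hm i
    rwa [if_neg (by omega)] at this
  · rw [Finset.erase_eq_of_notMem hm]

/-- Adding the largest missing steps to the two paths of the smaller matroid. -/
lemma LPM.Dominates.exists_step {z y : LPM n} (h : z.Dominates y) (hne : z ≠ y) :
    ∃ w : LPM n, w.U = insert (maxU z y) z.U ∧ w.L = insert (maxL z y) z.L ∧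
      maxU z y ∉ z.U ∧ maxL z y ∉ z.L ∧ z ≤ w ∧ w.Dominates y := by
  have hposU := h.card_pos hne
  have hposL := h.card_sdiff ▸ hposU
  have hu := sup_id_mem (Finset.card_pos.1 hposU)
  have hl := sup_id_mem (Finset.card_pos.1 hposL)
  have hhu := height_sup_id (y.U \ z.U)
  have hhl := height_sup_id (y.L \ z.L)
  change maxU z y ∈ _ at hu
  change maxL z y ∈ _ at hl
  change height _ (maxU z y) = _ at hhu
  change height _ (maxL z y) = _ at hhl
  have hub : ∀ a ∈ y.U \ z.U, a ≤ maxU z y := fun a ha => Finset.le_sup (f := id) ha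
  have hlb : ∀ a ∈ y.L \ z.L, a ≤ maxL z y := fun a ha => Finset.le_sup (f := id) ha
  generalize maxU z y = u at *
  generalize maxL z y = l at *
  have hu' := Finset.mem_sdiff.1 hu
  have hl' := Finset.mem_sdiff.1 hl
  have hc := h.card_sdiff
  have hgood := h.2.2 u hu l hl (by omega)
  have eU := height_sdiff h.1
  have eL := height_sdiff h.2.1
  -- Only `l ≤ i < u` could cause a crossing. There all missing lower steps but not all missing
  -- upper steps of `y` have been passed, so `y.noncrossing` leaves a surplus of one for `z`.
  have hnc : ∀ i, height (insert l z.L) i ≤ height (insert u z.U) i := by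
    intro i
    rw [height_insert hl'.2, height_insert hu'.2]
    have h1 := z.noncrossing i
    by_cases h2 : l ≤ i ∧ i < u
    · have h3 := y.noncrossing i
      have h4 := height_lt_of_mem hu h2.2 le_rfl
      have h5 := height_mono (y.L \ z.L) h2.1
      have h6 := eU i
      have h7 := eL i
      rw [if_pos h2.1, if_neg (by omega)]
      omega
    · split_ifs <;> omega
  let w : LPM n := ⟨insert u z.U, insert l z.L,
    Finset.insert_subset (y.U_subset hu'.1) z.U_subset,
    Finset.insert_subset (y.L_subset hl'.1) z.L_subset,
    by rw [Finset.card_insert_of_notMem hu'.2, Finset.card_insert_of_notMem hl'.2, z.card_eq], hnc⟩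
  have e1 : y.U \ w.U = (y.U \ z.U).erase u := by
    ext a
    simp only [w, Finset.mem_sdiff, Finset.mem_insert, Finset.mem_erase]
    tauto
  have e2 : y.L \ w.L = (y.L \ z.L).erase l := by
    ext a
    simp only [w, Finset.mem_sdiff, Finset.mem_insert, Finset.mem_erase]
    tauto
  refine ⟨w, rfl, rfl, hu'.2, hl'.2, LPM.le_of_good hu'.2 hl'.2 rfl rfl ?_ ?_,
    Finset.insert_subset hu'.1 h.1, Finset.insert_subset hl'.1 h.2.1, ?_⟩
  -- Passing from `y` to `w` lowers the heights at `u` and `l` by the same amount, so the good pair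
  -- inequalities survive.
  · change height (insert l z.L) l ≤ height (insert u z.U) u
    rw [height_insert hl'.2, height_insert hu'.2, if_pos le_rfl, if_pos le_rfl]
    have h6 := eU u
    have h7 := eL l
    omega
  · change u + height (insert l z.L) l ≤ l + height (insert u z.U) u
    rw [height_insert hl'.2, height_insert hu'.2, if_pos le_rfl, if_pos le_rfl]
    have h6 := eU u
    have h7 := eL l
    omega
  · intro a ha b hb hab
    rw [e1] at ha hab
    rw [e2] at hb hab
    rw [Finset.mem_erase] at ha hb
    have h8 := hub a ha.2
    have h9 := hlb b hb.2
    rw [height_erase_of_lt (by omega), height_erase_of_lt (by omega)] at hab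
    exact h.2.2 a ha.2 b hb.2 hab

lemma LPM.Dominates.le {z y : LPM n} (h : z.Dominates y) : z ≤ y := by
  induction hk : y.U.card - z.U.card using Nat.strong_induction_on generalizing z with
  | _ k ih =>
    by_cases hne : z = y
    · exact hne.le
    obtain ⟨w, hU, -, hu, -, hzw, hwy⟩ := h.exists_step hne
    refine hzw.trans (ih (y.U.card - w.U.card) ?_ hwy rfl)
    have h1 := h.card_pos hne
    rw [Finset.card_sdiff_of_subset h.1] at h1
    rw [hU, Finset.card_insert_of_notMem hu]
    omega

lemma LPM.card_lt_of_lt {z y : LPM n} (h : z < y) : z.U.card < y.U.card := by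
  have h1 := (LPM.dominates_of_le h.le).card_pos h.ne
  rw [Finset.card_sdiff_of_subset (LPM.U_subset_of_le h.le)] at h1
  omega

lemma LPM.covBy_of_le_of_card {z y : LPM n} (h : z ≤ y) (hc : y.U.card = z.U.card + 1) :
    z ⋖ y := by
  refine ⟨lt_of_le_of_ne h (by rintro rfl; omega), fun v h1 h2 => ?_⟩
  have := LPM.card_lt_of_lt h1
  have := LPM.card_lt_of_lt h2
  omega

/-! ### The first step of the rising chain of an interval -/

lemma LPM.exists_up {z y : LPM n} (h : z < y) :
    ∃ w : LPM n, w.U = insert (maxU z y) z.U ∧ w.L = insert (maxL z y) z.L ∧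
      maxU z y ∉ z.U ∧ maxL z y ∉ z.L ∧ z ⋖ w ∧ w ≤ y := by
  obtain ⟨w, h1, h2, h3, h4, h5, h6⟩ := (LPM.dominates_of_le h.le).exists_step h.ne
  refine ⟨w, h1, h2, h3, h4, LPM.covBy_of_le_of_card h5 ?_, h6.le⟩
  rw [h1, Finset.card_insert_of_notMem h3]

open Classical in
/-- The first element after `z` of the rising chain from `z` to `y`. -/
def LPM.up (z y : LPM n) : LPM n := if h : z < y then (LPM.exists_up h).choose else z

lemma LPM.up_spec {z y : LPM n} (h : z < y) :
    (z.up y).U = insert (maxU z y) z.U ∧ (z.up y).L = insert (maxL z y) z.L ∧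
      maxU z y ∉ z.U ∧ maxL z y ∉ z.L ∧ z ⋖ z.up y ∧ z.up y ≤ y := by
  rw [LPM.up, dif_pos h]
  exact (LPM.exists_up h).choose_spec

lemma LPM.covBy_up {z y : LPM n} (h : z < y) : z ⋖ z.up y := (LPM.up_spec h).2.2.2.2.1

lemma LPM.up_le {z y : LPM n} (h : z < y) : z.up y ≤ y := (LPM.up_spec h).2.2.2.2.2

lemma LPM.up_of_covBy {z y : LPM n} (h : z ⋖ y) : z.up y = y :=
  (h.eq_or_eq (LPM.covBy_up h.lt).le (LPM.up_le h.lt)).resolve_left (LPM.covBy_up h.lt).ne'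

/-- Cover relations add one step to each path; the two steps form a good pair. -/
lemma LPM.covBy_iff {z y : LPM n} : z ⋖ y ↔ ∃ u l, u ∉ z.U ∧ l ∉ z.L ∧ y.U = insert u z.U ∧
    y.L = insert l z.L ∧ height y.L l ≤ height y.U u ∧ u + height y.L l ≤ l + height y.U u := by
  constructor
  · intro h
    obtain ⟨h1, h2, h3, h4, -⟩ := LPM.up_spec h.lt
    rw [LPM.up_of_covBy h] at h1 h2
    refine ⟨_, _, h3, h4, h1, h2, ?_⟩
    have e1 : y.U \ z.U = {maxU z y} := by
      rw [h1, Finset.insert_sdiff_of_notMem _ h3, Finset.sdiff_self, ← LawfulSingleton.insert_empty_eq]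
    have e2 : y.L \ z.L = {maxL z y} := by
      rw [h2, Finset.insert_sdiff_of_notMem _ h4, Finset.sdiff_self, ← LawfulSingleton.insert_empty_eq]
    refine (LPM.dominates_of_le h.le).2.2 _ (by simp [e1]) _ (by simp [e2]) ?_
    rw [e1, e2]
    simp [height, Finset.filter_singleton]
  · rintro ⟨u, l, hu, hl, hU, hL, hN, hE⟩
    refine LPM.covBy_of_le_of_card (LPM.le_of_good hu hl hU hL hN hE) ?_
    rw [hU, Finset.card_insert_of_notMem hu]

lemma sup_insert_sdiff {S : Finset ℕ} {a : ℕ} (h : a ∉ S) : (insert a S \ S).sup id = a := by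
  have : insert a S \ S = {a} := by
    ext b
    simp only [Finset.mem_sdiff, Finset.mem_insert, Finset.mem_singleton]
    constructor
    · tauto
    · rintro rfl; tauto
  rw [this, Finset.sup_singleton, id]

lemma label_insert {z y : LPM n} {u l : ℕ} (hu : u ∉ z.U) (hl : l ∉ z.L)
    (hU : y.U = insert u z.U) (hL : y.L = insert l z.L) :
    label z y = OrderDual.toDual (u, l) := by
  rw [label, hU, hL, sup_insert_sdiff hu, sup_insert_sdiff hl]

lemma LPM.card_of_covBy {z y : LPM n} (h : z ⋖ y) : y.U.card = z.U.card + 1 := by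
  obtain ⟨u, l, hu, hl, hU, -⟩ := LPM.covBy_iff.1 h
  rw [hU, Finset.card_insert_of_notMem hu]

lemma LPM.label_up {z y : LPM n} (h : z < y) : label z (z.up y) = label z y := by
  obtain ⟨h1, h2, h3, h4, -⟩ := LPM.up_spec h
  rw [label_insert h3 h4 h1 h2, label_eq]

lemma maxU_mem {z y : LPM n} (h : z < y) : maxU z y ∈ y.U \ z.U :=
  sup_id_mem (Finset.card_pos.1 ((LPM.dominates_of_le h.le).card_pos h.ne))

lemma maxL_mem {z y : LPM n} (h : z < y) : maxL z y ∈ y.L \ z.L :=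
  sup_id_mem (Finset.card_pos.1
    ((LPM.dominates_of_le h.le).card_sdiff ▸ (LPM.dominates_of_le h.le).card_pos h.ne))

/-- The steps of a rising chain are rising. -/
lemma LPM.label_lt_label_up {z y : LPM n} (h : z < y) (h' : z.up y < y) :
    label z (z.up y) < label (z.up y) y := by
  obtain ⟨h1, h2, h3, h4, -⟩ := LPM.up_spec h
  rw [LPM.label_up h, label_eq, label_eq, OrderDual.toDual_lt_toDual]
  have e1 := maxU_mem h'
  have e2 := maxL_mem h'
  rw [h1, Finset.mem_sdiff, Finset.mem_insert, not_or] at e1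
  rw [h2, Finset.mem_sdiff, Finset.mem_insert, not_or] at e2
  have g1 : maxU (z.up y) y ≤ maxU z y :=
    Finset.le_sup (f := id) (Finset.mem_sdiff.2 ⟨e1.1, e1.2.2⟩)
  have g2 : maxL (z.up y) y ≤ maxL z y :=
    Finset.le_sup (f := id) (Finset.mem_sdiff.2 ⟨e2.1, e2.2.2⟩)
  exact Prod.mk_lt_mk.2 (Or.inl ⟨lt_of_le_of_ne g1 e1.2.1, g2⟩)

/-- A rising step into `w` is the first step of the rising chain to `y`. -/
lemma LPM.up_eq_of_label_lt {z w y : LPM n} (hzw : z ⋖ w) (hwy : w < y)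
    (h : label z w < label w y) : z.up y = w := by
  have hzy := hzw.lt.trans hwy
  rw [label_eq, label_eq, OrderDual.toDual_lt_toDual] at h
  have h' := Prod.mk_le_mk.1 h.le
  -- The rise says that both maxima over this union are attained by the step from `z` to `w`.
  have hU : y.U \ z.U = (y.U \ w.U) ∪ (w.U \ z.U) := by
    rw [Finset.sdiff_union_sdiff_cancel (LPM.U_subset_of_le hwy.le) (LPM.U_subset_of_le hzw.le)]
  have hL : y.L \ z.L = (y.L \ w.L) ∪ (w.L \ z.L) := by
    rw [Finset.sdiff_union_sdiff_cancel (LPM.L_subset_of_le hwy.le) (LPM.L_subset_of_le hzw.le)]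
  have e1 : maxU z y = maxU z w := by
    have : maxU z y = max (maxU w y) (maxU z w) := by
      unfold maxU
      rw [hU, Finset.sup_union]
    rw [this, max_eq_right h'.1]
  have e2 : maxL z y = maxL z w := by
    have : maxL z y = max (maxL w y) (maxL z w) := by
      unfold maxL
      rw [hL, Finset.sup_union]
    rw [this, max_eq_right h'.2]
  obtain ⟨h1, h2, -⟩ := LPM.up_spec hzy
  obtain ⟨h3, h4, -⟩ := LPM.up_spec hzw.lt
  rw [LPM.up_of_covBy hzw] at h3 h4
  exact LPM.ext (by rw [h1, h3, e1]) (by rw [h2, h4, e2])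

/-! ### Falling chains as lists -/

/-- The list of the elements of a chain that starts at `⊥`, from top to bottom, all of whose steps
are cover relations and none of whose consecutive labels are rising. -/
def IsFalling : List (LPM n) → Prop
  | [] => False
  | [x] => x = ⊥
  | y :: x :: t => x ⋖ y ∧ (∀ w ∈ t.head?, ¬ label w x < label x y) ∧ IsFalling (x :: t)

lemma isFalling_singleton {x : LPM n} : IsFalling [x] ↔ x = ⊥ := Iff.rfl

lemma isFalling_cons_cons {y x : LPM n} {t : List (LPM n)} : IsFalling (y :: x :: t) ↔
    x ⋖ y ∧ (∀ w ∈ t.head?, ¬ label w x < label x y) ∧ IsFalling (x :: t) := Iff.rfl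

lemma IsFalling.isChain {l : List (LPM n)} (h : IsFalling l) : l.IsChain (· > ·) := by
  induction l with
  | nil => exact List.isChain_nil
  | cons y t ih =>
    cases t with
    | nil => exact List.isChain_singleton y
    | cons x t => exact List.isChain_cons_cons.2 ⟨h.1.lt, ih h.2.2⟩

lemma bot_U : (⊥ : LPM n).U = ∅ := rfl

lemma top_U : (⊤ : LPM n).U = Finset.Icc 1 n := rfl

lemma top_L : (⊤ : LPM n).L = Finset.Icc 1 n := rfl

lemma bot_L : (⊥ : LPM n).L = ∅ := rfl

lemma IsFalling.length_eq {y : LPM n} {t : List (LPM n)} (h : IsFalling (y :: t)) :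
    t.length = y.U.card := by
  induction t generalizing y with
  | nil =>
    rw [isFalling_singleton] at h
    simp [h, bot_U]
  | cons x t ih => rw [LPM.card_of_covBy h.1, List.length_cons, ih h.2.2]

lemma finite_isFalling (n : ℕ) : {l : List (LPM n) | IsFalling l}.Finite := by
  refine Set.Finite.subset (s := {l : List (LPM n) | l.Nodup}) ?_ fun l hl => ?_
  · exact Set.finite_coe_iff.1 (Finite.of_injective
      (fun l => (⟨l.1, l.2⟩ : {l : List (LPM n) // l.Nodup}))
      fun a b h => Subtype.ext (Subtype.mk.inj h))
  · have h := (List.isChain_iff_pairwise.1 hl.isChain)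
    exact h.imp fun hab => ne_of_gt hab

/-- All falling chains starting at `⊥`. -/
def falling (n : ℕ) : Finset (List (LPM n)) := (finite_isFalling n).toFinset

lemma mem_falling {l : List (LPM n)} : l ∈ falling n ↔ IsFalling l := by
  simp [falling]

/-- The falling chains from `⊥` to `y`. -/
def fallingTo (y : LPM n) : Finset (List (LPM n)) := (falling n).filter (fun l => l.headD ⊥ = y)

/-- The default value of `headD` is harmless, since the empty list is not falling. -/
lemma mem_fallingTo {y : LPM n} {l : List (LPM n)} :
    l ∈ fallingTo y ↔ IsFalling l ∧ l.headD ⊥ = y := by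
  rw [fallingTo, Finset.mem_filter, mem_falling]

/-! ### The sign-reversing involution -/

open Classical in
/-- Moving the place where a falling chain is continued by the rising chain to `y`. -/
def moveJunction (y : LPM n) : List (LPM n) → List (LPM n)
  | [] => []
  | [z] => [z.up y, z]
  | z :: x :: t => if z = y ∨ label x z < label z y then x :: t else z.up y :: z :: x :: t

/-- If the last falling step continues the rising chain to `y` downwards, it is handed over to that
chain; otherwise the first rising step is handed over to the falling chain. `label_up` lets `label z
y` stand for the label of that first step. -/
lemma isFalling_moveJunction {y : LPM n} (hy : y ≠ ⊥) {l : List (LPM n)} (hl : IsFalling l)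
    (hle : l.headD ⊥ ≤ y) : IsFalling (moveJunction y l) ∧ (moveJunction y l).headD ⊥ ≤ y ∧
      moveJunction y (moveJunction y l) = l ∧
      ((moveJunction y l).length = l.length + 1 ∨ l.length = (moveJunction y l).length + 1) := by
  match l with
  | [] => exact hl.elim
  | [z] =>
    rw [isFalling_singleton] at hl
    subst hl
    have hlt : ⊥ < y := bot_lt_iff_ne_bot.2 hy
    have hup := LPM.up_le hlt
    refine ⟨⟨LPM.covBy_up hlt, by simp, rfl⟩, hup, ?_, Or.inl rfl⟩
    rw [moveJunction, moveJunction, if_pos]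
    rcases hup.eq_or_lt with h | h
    · exact Or.inl h
    · exact Or.inr (LPM.label_lt_label_up hlt h)
  | z :: x :: t =>
    rw [List.headD_cons] at hle
    have hxz := hl.1
    by_cases hc : z = y ∨ label x z < label z y
    · rw [moveJunction, if_pos hc]
      have hxy : x < y := hxz.lt.trans_le hle
      have hup : x.up y = z := by
        rcases hle.eq_or_lt with h | h
        · subst h
          exact LPM.up_of_covBy hxz
        · exact LPM.up_eq_of_label_lt hxz h (hc.resolve_left h.ne)
      refine ⟨hl.2.2, hxy.le, ?_, Or.inr rfl⟩
      cases t with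
      | nil => rw [moveJunction, hup]
      | cons w t =>
        rw [moveJunction, if_neg, hup]
        rintro (h | h)
        -- If the shortened chain ended in a rise, then, as `label x y` is the label of the removed
        -- step, the original chain would not have been falling.
        · exact hxy.ne h
        · refine hl.2.1 w rfl ?_
          rwa [← hup, LPM.label_up hxy]
    · rw [moveJunction, if_neg hc]
      have hlt : z < y := lt_of_le_of_ne hle fun h => hc (Or.inl h)
      have hup := LPM.up_le hlt
      refine ⟨⟨LPM.covBy_up hlt, ?_, hl⟩, hup, ?_, Or.inl rfl⟩
      · intro w hw
        rw [List.head?_cons, Option.mem_some_iff] at hw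
        subst hw
        rw [LPM.label_up hlt]
        exact fun h => hc (Or.inr h)
      · rw [moveJunction, if_pos]
        rcases hup.eq_or_lt with h | h
        · exact Or.inl h
        · exact Or.inr (LPM.label_lt_label_up hlt h)

lemma sum_fallingTo {y : LPM n} (hy : y ≠ ⊥) :
    ∑ x ∈ Finset.Icc ⊥ y, (-1 : ℤ) ^ x.U.card * (fallingTo x).card = 0 := by
  classical
  -- A list ending at `x` has `x.U.card + 1` entries, hence the exponent `l.length + 1`.
  have h1 : ∑ l ∈ (falling n).filter (fun l => l.headD ⊥ ≤ y), (-1 : ℤ) ^ (l.length + 1) = 0 := by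
    have hmem : ∀ l ∈ (falling n).filter (fun l => l.headD ⊥ ≤ y),
        IsFalling l ∧ l.headD ⊥ ≤ y := fun l hl => by
      rwa [Finset.mem_filter, mem_falling] at hl
    refine Finset.sum_involution (fun l _ => moveJunction y l) ?_ ?_ ?_ ?_
    · intro l hl
      obtain ⟨-, -, -, h | h⟩ := isFalling_moveJunction hy (hmem l hl).1 (hmem l hl).2 <;>
      rw [h] <;> ring
    · intro l hl _ heq
      obtain ⟨-, -, -, h⟩ := isFalling_moveJunction hy (hmem l hl).1 (hmem l hl).2
      rw [heq] at h
      omega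
    · intro l hl
      rw [Finset.mem_filter, mem_falling]
      obtain ⟨h1, h2, -⟩ := isFalling_moveJunction hy (hmem l hl).1 (hmem l hl).2
      exact ⟨h1, h2⟩
    · intro l hl
      exact (isFalling_moveJunction hy (hmem l hl).1 (hmem l hl).2).2.2.1
  rw [← h1, ← Finset.sum_fiberwise_of_maps_to (t := Finset.Icc ⊥ y) (g := fun l : List (LPM n) => l.headD ⊥)
    (by
      intro l hl
      rw [Finset.mem_filter] at hl
      exact Finset.mem_Icc.2 ⟨bot_le, hl.2⟩)]
  refine Finset.sum_congr rfl fun x hx => ?_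
  have h2 : ((falling n).filter (fun l => l.headD ⊥ ≤ y)).filter (fun l => l.headD ⊥ = x)
      = fallingTo x := by
    ext l
    rw [Finset.mem_filter, Finset.mem_filter, mem_fallingTo, mem_falling]
    constructor
    · rintro ⟨⟨h, -⟩, h'⟩
      exact ⟨h, h'⟩
    · rintro ⟨h, rfl⟩
      exact ⟨⟨h, (Finset.mem_Icc.1 hx).2⟩, rfl⟩
  rw [h2, Finset.sum_congr rfl (g := fun _ => (-1 : ℤ) ^ x.U.card), Finset.sum_const, nsmul_eq_mul,
    mul_comm]
  intro l hl
  rw [mem_fallingTo] at hl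
  obtain ⟨h3, h4⟩ := hl
  match l with
  | [] => exact h3.elim
  | z :: t =>
    rw [List.headD_cons] at h4
    subst h4
    rw [List.length_cons, h3.length_eq]
    ring

lemma fallingTo_bot : fallingTo (⊥ : LPM n) = {[⊥]} := by
  ext l
  rw [mem_fallingTo, Finset.mem_singleton]
  constructor
  · rintro ⟨h1, h2⟩
    match l with
    | [] => exact h1.elim
    | [z] => rw [isFalling_singleton.1 h1]
    | z :: x :: t =>
      rw [List.headD_cons] at h2
      subst h2
      exact absurd h1.1.lt not_lt_bot
  · rintro rfl
    exact ⟨rfl, rfl⟩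

/-- The Möbius function counts falling chains. -/
lemma mu_bot_eq (y : LPM n) :
    IncidenceAlgebra.mu ℤ ⊥ y = (-1) ^ y.U.card * ((fallingTo y).card : ℤ) := by
  induction y using WellFoundedLT.induction with
  | ind y ih =>
    by_cases hy : y = ⊥
    · subst hy
      simp [fallingTo_bot, bot_U]
    · rw [IncidenceAlgebra.mu_eq_neg_sum_Ico_of_ne (Ne.symm hy)]
      have h := sum_fallingTo hy
      rw [← Finset.sum_Ico_add_eq_sum_Icc bot_le] at h
      rw [Finset.sum_congr rfl fun x hx => ih x (Finset.mem_Ico.1 hx).2]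
      linarith

lemma mobiusNumber_eq (n : ℕ) :
    mobiusNumber n = (-1) ^ n * ((fallingTo (⊤ : LPM n)).card : ℤ) := by
  rw [mobiusNumber, mu_bot_eq, top_U, Nat.card_Icc, Nat.add_sub_cancel]

/-! ### The falling chains as relation series -/

lemma isFalling_iff {l : List (LPM n)} : IsFalling l ↔ l.getLast? = some ⊥ ∧
    l.IsChain (fun y x => x ⋖ y) ∧ ∀ i, ∀ h : i + 2 < l.length,
      ¬ label l[i + 2] l[i + 1] < label l[i + 1] l[i] := by
  induction l with
  | nil => simp [IsFalling]
  | cons y t ih =>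
    cases t with
    | nil => simp [isFalling_singleton]
    | cons x t =>
      rw [isFalling_cons_cons, ih, List.isChain_cons_cons, List.getLast?_cons_cons]
      have key : (∀ i, ∀ h : i + 2 < (y :: x :: t).length,
          ¬ label (y :: x :: t)[i + 2] (y :: x :: t)[i + 1]
            < label (y :: x :: t)[i + 1] (y :: x :: t)[i]) ↔
          (∀ w ∈ t.head?, ¬ label w x < label x y) ∧ ∀ i, ∀ h : i + 2 < (x :: t).length,
            ¬ label (x :: t)[i + 2] (x :: t)[i + 1] < label (x :: t)[i + 1] (x :: t)[i] := by
        constructor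
        · intro H
          refine ⟨fun w hw => ?_, fun i h => ?_⟩
          · cases t with
            | nil => simp at hw
            | cons w' t =>
              rw [List.head?_cons, Option.mem_some_iff] at hw
              subst hw
              exact H 0 (by simp)
          · exact H (i + 1) (by simpa using h)
        · rintro ⟨H1, H2⟩ i h
          cases i with
          | zero =>
            cases t with
            | nil => simp at h
            | cons w' t => exact H1 w' rfl
          | succ i => exact H2 i (by simpa using h)
      rw [key]
      tauto

lemma mem_fallingChains_iff (c : RelSeries {(a, b) : LPM n × LPM n | a ⋖ b}) :
    c ∈ fallingChains n ↔ c.toList.reverse ∈ fallingTo (⊤ : LPM n) := by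
  rw [mem_fallingTo, isFalling_iff]
  have e1 : c.toList.reverse.getLast? = some c.head := by
    rw [List.getLast?_reverse, List.head?_eq_some_head c.toList_ne_nil, RelSeries.head_toList]
  have e2 : c.toList.reverse.headD ⊥ = c.last := by
    rw [List.headD_eq_head?_getD, List.head?_reverse, List.getLast?_eq_some_getLast c.toList_ne_nil,
      RelSeries.getLast_toList, Option.getD_some]
  have e3 : c.toList.reverse.IsChain (fun y x => x ⋖ y) := by
    rw [List.isChain_reverse]
    exact c.isChain_toList
  have e4 : (∀ i j : Fin c.length, (i : ℕ) + 1 = j →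
      ¬ label (c i.castSucc) (c i.succ) < label (c j.castSucc) (c j.succ)) ↔
      ∀ i, ∀ h : i + 2 < c.toList.reverse.length,
      ¬ label c.toList.reverse[i + 2] c.toList.reverse[i + 1]
        < label c.toList.reverse[i + 1] c.toList.reverse[i] := by
    have hlen : c.toList.reverse.length = c.length + 1 := by simp
    -- The series runs upwards and the list downwards, so indices are reflected.
    have hget : ∀ i (h : i < c.toList.reverse.length),
        c.toList.reverse[i] = c ⟨c.length - i, by omega⟩ := by
      intro i h
      rw [List.getElem_reverse, RelSeries.toList_getElem]
      congr 1
      ext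
      simp
    constructor
    · intro H i h
      rw [hget, hget, hget]
      have s1 : (⟨c.length - (i + 2), by omega⟩ : Fin c.length).succ
          = ⟨c.length - (i + 1), by omega⟩ := Fin.ext (by rw [Fin.val_succ]; lia)
      have s2 : (⟨c.length - (i + 1), by omega⟩ : Fin c.length).succ
          = ⟨c.length - i, by omega⟩ := Fin.ext (by rw [Fin.val_succ]; lia)
      have := H ⟨c.length - (i + 2), by omega⟩ ⟨c.length - (i + 1), by omega⟩
        (show c.length - (i + 2) + 1 = c.length - (i + 1) by omega)
      rw [s1, s2] at this
      exact this
    · intro H i j hij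
      have hi := i.2
      have hj := j.2
      have := H (c.length - (i + 2)) (by omega)
      rw [hget, hget, hget] at this
      have s0 : (⟨c.length - (c.length - (i + 2) + 2), by omega⟩ : Fin (c.length + 1))
          = i.castSucc := Fin.ext (by rw [Fin.val_castSucc]; lia)
      have s1 : (⟨c.length - (c.length - (i + 2) + 1), by omega⟩ : Fin (c.length + 1))
          = i.succ := Fin.ext (by rw [Fin.val_succ]; lia)
      have s2 : (⟨c.length - (c.length - (i + 2)), by omega⟩ : Fin (c.length + 1))
          = j.succ := Fin.ext (by rw [Fin.val_succ]; lia)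
      have s3 : i.succ = j.castSucc := Fin.ext (by rw [Fin.val_succ, Fin.val_castSucc, hij])
      rw [s0, s1, s2] at this
      rwa [← s3]
  rw [e1, e2, ← e4]
  simp only [fallingChains, Set.mem_ofPred_eq, Option.some.injEq]
  tauto

lemma ncard_fallingChains (n : ℕ) : (fallingChains n).ncard = (fallingTo (⊤ : LPM n)).card := by
  rw [← Set.ncard_coe_finset]
  refine Set.ncard_congr (fun c _ => c.toList.reverse) ?_ ?_ ?_
  · intro c hc
    exact (mem_fallingChains_iff c).1 hc
  · intro c d _ _ h
    exact RelSeries.toList_injective (List.reverse_injective h)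
  · intro l hl
    have h := (isFalling_iff.1 (mem_fallingTo.1 hl).1).2.1
    have hne : l.reverse ≠ [] := by
      rw [Ne, List.reverse_eq_nil_iff]
      rintro rfl
      exact (mem_fallingTo.1 hl).1
    have hch : l.reverse.IsChain
        (fun a b => (a, b) ∈ {(a, b) : LPM n × LPM n | a ⋖ b}) := by
      rw [List.isChain_reverse]
      exact h
    have e : (RelSeries.fromListIsChain l.reverse hne hch).toList.reverse = l := by
      rw [RelSeries.toList_fromListIsChain, List.reverse_reverse]
    exact ⟨_, (mem_fallingChains_iff _).2 (by rw [e]; exact hl), e⟩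

/-! ### Prolonging falling chains -/

/-- The increasing map on the positive integers that skips the value `b`. -/
def skip (b m : ℕ) : ℕ := if m < b then m else m + 1

lemma skip_strictMono (b : ℕ) : StrictMono (skip b) := by
  intro i j h
  unfold skip
  split_ifs <;> omega

lemma height_image_skip (b : ℕ) (S : Finset ℕ) (i : ℕ) :
    height (S.image (skip b)) (skip b i) = height S i := by
  unfold height
  rw [Finset.filter_image, Finset.card_image_of_injective _ (skip_strictMono b).injective]
  simp only [(skip_strictMono b).le_iff_le]

lemma height_image_skip_le (b : ℕ) (S : Finset ℕ) (i : ℕ) :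
    height (S.image (skip b)) i ≤ height S i := by
  rw [← height_image_skip b S i]
  refine height_mono _ ?_
  unfold skip
  split_ifs <;> omega

lemma image_skip_subset (b : ℕ) {S : Finset ℕ} (h : S ⊆ Finset.Icc 1 n) :
    S.image (skip b) ⊆ Finset.Icc 1 (n + 1) := by
  intro a ha
  obtain ⟨m, hm, rfl⟩ := Finset.mem_image.1 ha
  have := Finset.mem_Icc.1 (h hm)
  rw [Finset.mem_Icc]
  unfold skip
  split_ifs <;> omega

/-- Adding an east step to the end of the upper path and as the `b`-th step of the lower path. -/
def LPM.addEast (b : ℕ) (M : LPM n) : LPM (n + 1) where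
  U := M.U
  L := M.L.image (skip b)
  U_subset := M.U_subset.trans (Finset.Icc_subset_Icc_right n.le_succ)
  L_subset := image_skip_subset b M.L_subset
  card_eq := by rw [Finset.card_image_of_injective _ (skip_strictMono b).injective, M.card_eq]
  noncrossing i := (height_image_skip_le b _ i).trans (M.noncrossing i)

lemma LPM.addEast_U (b : ℕ) (M : LPM n) : (M.addEast b).U = M.U := rfl

lemma LPM.addEast_L (b : ℕ) (M : LPM n) : (M.addEast b).L = M.L.image (skip b) := rfl

lemma LPM.addEast_injective (b : ℕ) : Function.Injective (LPM.addEast b (n := n)) := by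
  intro M M' h
  have hU : (M.addEast b).U = (M'.addEast b).U := by rw [h]
  have hL : (M.addEast b).L = (M'.addEast b).L := by rw [h]
  exact LPM.ext hU (Finset.image_injective (skip_strictMono b).injective hL)

lemma LPM.addEast_bot (b : ℕ) : (⊥ : LPM n).addEast b = ⊥ :=
  LPM.ext rfl (by rw [LPM.addEast_L, bot_L, bot_L, Finset.image_empty])

/-- The heights of the matched north steps do not change and the lower one can only move to the
right, so a good pair stays good. -/
lemma LPM.addEast_covBy (b : ℕ) {z y : LPM n} (h : z ⋖ y) : ∃ u l,
    label z y = OrderDual.toDual (u, l) ∧ u ∈ y.U ∧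
    label (z.addEast b) (y.addEast b) = OrderDual.toDual (u, skip b l) ∧
    z.addEast b ⋖ y.addEast b := by
  obtain ⟨u, l, hu, hl, hU, hL, hN, hE⟩ := LPM.covBy_iff.1 h
  have hl' : skip b l ∉ (z.addEast b).L := by
    rw [LPM.addEast_L, (skip_strictMono b).injective.mem_finset_image]
    exact hl
  have hL' : (y.addEast b).L = insert (skip b l) (z.addEast b).L := by
    rw [LPM.addEast_L, LPM.addEast_L, hL, Finset.image_insert]
  refine ⟨u, l, label_insert hu hl hU hL, hU ▸ Finset.mem_insert_self _ _,
    label_insert hu hl' hU hL', LPM.covBy_iff.2 ⟨u, skip b l, hu, hl', hU, hL', ?_, ?_⟩⟩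
  · rw [LPM.addEast_L, height_image_skip]
    exact hN
  · rw [LPM.addEast_L, height_image_skip]
    have : l ≤ skip b l := by
      unfold skip
      split_ifs <;> omega
    exact hE.trans (Nat.add_le_add_right this _)

lemma LPM.label_addEast_lt (b : ℕ) {w x y : LPM n} (h₁ : w ⋖ x) (h₂ : x ⋖ y)
    (h : label (w.addEast b) (x.addEast b) < label (x.addEast b) (y.addEast b)) :
    label w x < label x y := by
  obtain ⟨u₁, l₁, e₁, -, f₁, -⟩ := LPM.addEast_covBy b h₁
  obtain ⟨u₂, l₂, e₂, -, f₂, -⟩ := LPM.addEast_covBy b h₂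
  rw [f₁, f₂, OrderDual.toDual_lt_toDual, Prod.mk_lt_mk, (skip_strictMono b).le_iff_le,
    (skip_strictMono b).lt_iff_lt] at h
  rwa [e₁, e₂, OrderDual.toDual_lt_toDual, Prod.mk_lt_mk]

lemma IsFalling.map_addEast (b : ℕ) {l : List (LPM n)} (h : IsFalling l) :
    IsFalling (l.map (LPM.addEast b)) := by
  induction l with
  | nil => exact h
  | cons y t ih =>
    cases t with
    | nil =>
      rw [isFalling_singleton] at h
      subst h
      exact LPM.addEast_bot b
    | cons x t =>
      obtain ⟨_, _, -, -, -, hc⟩ := LPM.addEast_covBy b h.1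
      refine ⟨hc, ?_, ih h.2.2⟩
      intro w' hw' hlt
      cases t with
      | nil => simp at hw'
      | cons w t =>
        rw [List.map_cons, List.head?_cons, Option.mem_some_iff] at hw'
        subst hw'
        exact h.2.1 w rfl (LPM.label_addEast_lt b h.2.2.1 h.1 hlt)

/-! ### The last cover, into the greatest element -/

lemma image_skip_Icc {b : ℕ} (hb : b ∈ Finset.Icc 1 (n + 1)) :
    b ∉ (Finset.Icc 1 n).image (skip b) ∧
      Finset.Icc 1 (n + 1) = insert b ((Finset.Icc 1 n).image (skip b)) := by
  rw [Finset.mem_Icc] at hb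
  constructor
  · rw [Finset.mem_image]
    rintro ⟨m, -, hm⟩
    unfold skip at hm
    split_ifs at hm <;> omega
  · ext a
    rw [Finset.mem_insert, Finset.mem_image, Finset.mem_Icc]
    constructor
    · intro ha
      rcases Nat.lt_trichotomy a b with h | h | h
      · exact Or.inr ⟨a, Finset.mem_Icc.2 (by omega), if_pos h⟩
      · exact Or.inl h
      · exact Or.inr ⟨a - 1, Finset.mem_Icc.2 (by omega), by
          rw [skip, if_neg (by omega)]; omega⟩
    · rintro (rfl | ⟨m, hm, rfl⟩)
      · exact hb
      · rw [Finset.mem_Icc] at hm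
        unfold skip
        split_ifs <;> omega

lemma LPM.addEast_top {b : ℕ} (hb : b ∈ Finset.Icc 1 (n + 1)) :
    (⊤ : LPM n).addEast b ⋖ ⊤ ∧
      label ((⊤ : LPM n).addEast b) ⊤ = OrderDual.toDual (n + 1, b) := by
  obtain ⟨h1, h2⟩ := image_skip_Icc hb
  have hu : n + 1 ∉ ((⊤ : LPM n).addEast b).U := by
    rw [LPM.addEast_U, top_U, Finset.mem_Icc]
    omega
  have hl : b ∉ ((⊤ : LPM n).addEast b).L := h1
  have hU : (⊤ : LPM (n + 1)).U = insert (n + 1) ((⊤ : LPM n).addEast b).U := by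
    ext a
    rw [LPM.addEast_U, top_U, top_U, Finset.mem_insert, Finset.mem_Icc, Finset.mem_Icc]
    omega
  have hL : (⊤ : LPM (n + 1)).L = insert b ((⊤ : LPM n).addEast b).L := h2
  refine ⟨LPM.covBy_of_le_of_card le_top ?_, label_insert hu hl hU hL⟩
  rw [hU, Finset.card_insert_of_notMem hu]

/-- In the dual order a rise needs weakly decreasing first coordinates, but the last one is `n + 1`
and those before it are at most `n`. -/
lemma isFalling_top_cons {b : ℕ} (hb : b ∈ Finset.Icc 1 (n + 1)) {l : List (LPM n)}
    (h : l ∈ fallingTo (⊤ : LPM n)) :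
    (⊤ :: l.map (LPM.addEast b) : List (LPM (n + 1))) ∈ fallingTo (⊤ : LPM (n + 1)) := by
  rw [mem_fallingTo] at h ⊢
  refine ⟨?_, rfl⟩
  obtain ⟨h1, h2⟩ := h
  obtain ⟨hc, hlab⟩ := LPM.addEast_top hb
  match l with
  | [] => exact h1.elim
  | y :: t =>
    rw [List.headD_cons] at h2
    subst h2
    refine ⟨hc, ?_, h1.map_addEast b⟩
    intro w' hw' hlt
    match t with
    | [] => simp at hw'
    | x :: t =>
      rw [List.map_cons, List.head?_cons, Option.mem_some_iff] at hw'
      subst hw'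
      obtain ⟨u, l, -, hu, hl, -⟩ := LPM.addEast_covBy b h1.1
      rw [hlab, hl, OrderDual.toDual_lt_toDual] at hlt
      rw [top_U, Finset.mem_Icc] at hu
      have := (Prod.mk_le_mk.1 hlt.le).1
      omega

lemma card_fallingTo_succ (n : ℕ) :
    (n + 1) * (fallingTo (⊤ : LPM n)).card ≤ (fallingTo (⊤ : LPM (n + 1))).card := by
  have h := Finset.card_le_card_of_injOn
    (s := Finset.Icc 1 (n + 1) ×ˢ fallingTo (⊤ : LPM n)) (t := fallingTo (⊤ : LPM (n + 1)))
    (fun p => ⊤ :: p.2.map (LPM.addEast p.1)) ?_ ?_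
  · rwa [Finset.card_product, Nat.card_Icc, Nat.add_sub_cancel] at h
  · rintro ⟨b, l⟩ hp
    have hp := Finset.mem_product.1 hp
    exact isFalling_top_cons hp.1 hp.2
  · rintro ⟨b, l⟩ hp ⟨b', l'⟩ hp' heq
    have hp := Finset.mem_product.1 hp
    have hp' := Finset.mem_product.1 hp'
    have heq := (List.cons.inj heq).2
    simp only at hp hp' heq
    -- `b` is the only element of `[n+1]` missing from the lower path just below `⊤`.
    have hb : b = b' := by
      obtain ⟨h1, h2⟩ := mem_fallingTo.1 hp.2
      obtain ⟨h1', h2'⟩ := mem_fallingTo.1 hp'.2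
      match l, l' with
      | [], _ => exact h1.elim
      | _ :: _, [] => exact h1'.elim
      | y :: t, y' :: t' =>
        rw [List.headD_cons] at h2 h2'
        subst h2 h2'
        have h3 := congrArg LPM.L (List.cons.inj heq).1
        obtain ⟨h4, -⟩ := image_skip_Icc hp.1
        obtain ⟨-, h5⟩ := image_skip_Icc hp'.1
        have h6 := h5 ▸ hp.1
        rcases Finset.mem_insert.1 h6 with h | h
        · exact h
        · rw [LPM.addEast_L, LPM.addEast_L, top_L] at h3
          rw [← h3] at h
          exact absurd h h4
    subst hb
    rw [List.map_injective_iff.2 (LPM.addEast_injective b) heq]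

lemma factorial_le_card_fallingTo (n : ℕ) : n.factorial ≤ (fallingTo (⊤ : LPM n)).card := by
  induction n with
  | zero =>
    have h : (⊤ : LPM 0) = ⊥ := LPM.ext (by simp [top_U, bot_U]) (by simp [top_L, bot_L])
    rw [h, fallingTo_bot]
    simp
  | succ n ih =>
    rw [Nat.factorial_succ]
    exact (Nat.mul_le_mul_left _ ih).trans (card_fallingTo_succ n)

end LatticePath

end

theorem corollary3p10 :
    (∀ n : ℕ, 2 ≤ n →
      (n + 1) * (LatticePath.fallingChains n).ncard ≤ (LatticePath.fallingChains (n + 1)).ncard) ∧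
    (∀ n : ℕ, (n.factorial : ℤ) ≤ (-1) ^ n * LatticePath.mobiusNumber n) := by
  refine ⟨fun n _ => ?_, fun n => ?_⟩
  · rw [LatticePath.ncard_fallingChains, LatticePath.ncard_fallingChains]
    exact LatticePath.card_fallingTo_succ n
  · rw [LatticePath.mobiusNumber_eq, ← mul_assoc, ← mul_pow, neg_one_mul, neg_neg, one_pow, one_mul]
    exact_mod_cast LatticePath.factorial_le_card_fallingTo n
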